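/- Proposition (extremals as singularities of the extremity mapping). Let $\Omega\subset\mathbb R^2$ be open and let $F_0,F_1,F_2$ be $C^\infty$ vector fields on $\Omega$ such that $F_1(q),F_2(q)$ are linearly independent for every $q\in\Omega$. Consider the control system $$\dot q=F_0(q)+u_1F_1(q)+u_2F_2(q),\qquad q(0)=q_0,$$ and write $q(t,q_0,u)$ for its response (Carathéodory solution in $\Omega$) to a control $u\in L^\infty([0,\infty);\mathbb R^2)$, whenever it is defined on $[0,t]$. Let $\mathcal S$ be the set of controls with $\|u(t)\|=1$ for almost every $t$, endowed with the $L^\infty$-norm topology. The fixed-time extremity mapping at time $T$ is $u\in\mathcal S\mapsto q(T,q_0,u)$, and the (free-time) extremity mapping is $(t,u)\in[0,\infty)\times\mathcal S\mapsto q(t,q_0,u)$. A point is called a singularity of one of these mappings if the mapping is defined near this point and Fréchet differentiable there along $\mathcal S$ (resp. along $[0,\infty)\times\mathcal S$) and the image under its derivative of the tangent space of $\mathcal S$ (resp. of $[0,\infty)\times\mathcal S$) at the point is not all of $\mathbb R^2$, i.e. the derivative is not of maximal rank. Let $H_i(q,p)=p\cdot F_i(q)$ and $\mathbf H=H_0+\sqrt{H_1^2+H_2^2}+p^0$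 with a constant $p^0\in\mathbb R$. Let $T>0$ and let $z=(q,p)$ be an extremal on $[0,T]$: $q(t)\in\Omega$ and $p(t)\neq0$ for all $t\in[0,T]$, and $$\dot q=\frac{\partial\mathbf H}{\partial p}(z),\qquad \dot p=-\frac{\partial\mathbf H}{\partial q}(z),\qquad \mathbf H(z)=0\quad\text{on }[0,T].$$ Put $q_0=q(0)$, and let $u\in\mathcal S$ be a control whose restriction to $[0,T]$ is the corresponding control, $u_i(t)=H_i(z(t))/\sqrt{H_1(z(t))^2+H_2(z(t))^2}$ for $i=1,2$ and almost every $t\in[0,T]$. 1. In the normal case $p^0\neq0$, $u$ is a singularity of the fixed-time extremity mapping at time $T$. 2. In the abnormal case $p^0=0$, if the values of $u$ after time $T$ are chosen so that $u$ has a representative that is continuous at $T$, then $(T,u)$ is a singularity of the free-time extremity mapping. -/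

import Mathlib

open MeasureTheory Set Topology
open scoped ENNReal

noncomputable section

/-- The Euclidean plane. -/
abbrev Plane : Type := EuclideanSpace ℝ (Fin 2)

/-- A planar Zermelo navigation problem `q' = F₀(q) + u₁ F₁(q) + u₂ F₂(q)` on an open set `dom`,
with smooth fields such that the control fields `field 0`, `field 1` form a frame. -/
structure ZermeloSystem where
  dom : Set Plane
  isOpen_dom : IsOpen dom
  drift : Plane → Plane
  field : Fin 2 → Plane → Plane
  smooth_drift : ContDiffOn ℝ ((⊤ : ℕ∞) : WithTop ℕ∞) drift dom
  smooth_field : ∀ i, ContDiffOn ℝ ((⊤ : ℕ∞) : WithTop ℕ∞) (field i) dom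
  frame : ∀ q ∈ dom, LinearIndependent ℝ (fun i => field i q)

/-- `L^∞([0,∞); ℝ²)` with its norm topology (controls up to equality almost everywhere). -/
abbrev Control : Type := Lp Plane (⊤ : ℝ≥0∞) (volume.restrict (Ici (0 : ℝ)))

/-- The controls with values in the unit circle. -/
def circleControls : Set Control :=
  {u | ∀ᵐ t ∂(volume.restrict (Ici (0 : ℝ))), ‖(u : ℝ → Plane) t‖ = 1}

namespace ZermeloSystem

variable (Z : ZermeloSystem)

/-- The right-hand side of the dynamics. -/
def velocity (q v : Plane) : Plane := Z.drift q + ∑ i, v i • Z.field i q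

/-- `γ` is the response on `[0,t]` to the control `u`, issued from `q₀` (a Carathéodory solution:
the integral form of the equation). -/
def IsResponse (q₀ : Plane) (u : Control) (t : ℝ) (γ : ℝ → Plane) : Prop :=
  ContinuousOn γ (Icc 0 t) ∧
    ∀ s ∈ Icc 0 t, γ s ∈ Z.dom ∧
      γ s = q₀ + ∫ r in (0 : ℝ)..s, Z.velocity (γ r) ((u : ℝ → Plane) r)

/-- The response to `u` from `q₀` is defined on the whole of `[0,t]`. -/
def HasResponse (q₀ : Plane) (u : Control) (t : ℝ) : Prop :=
  ∃ γ : ℝ → Plane, Z.IsResponse q₀ u t γ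

open Classical in
/-- The value `q(t, q₀, u)` at time `t` of the response (`0` when the response does not exist
on `[0,t]`). -/
def extremity (q₀ : Plane) (t : ℝ) (u : Control) : Plane :=
  if h : Z.HasResponse q₀ u t then h.choose t else 0

/-- Hamiltonian lift of the drift: `H₀(q,p) = p · F₀(q)`. -/
def driftLift (q p : Plane) : ℝ := inner ℝ p (Z.drift q)

/-- Hamiltonian lifts of the control fields: `Hᵢ(q,p) = p · Fᵢ(q)`. -/
def fieldLift (i : Fin 2) (q p : Plane) : ℝ := inner ℝ p (Z.field i q)

/-- The maximized Hamiltonian `H₀ + √(H₁² + H₂²) + p⁰`. -/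
def maxHamiltonian (p₀ : ℝ) (q p : Plane) : ℝ :=
  Z.driftLift q p + Real.sqrt (∑ i, Z.fieldLift i q p ^ 2) + p₀

/-- The maximizing control `uᵢ = Hᵢ / √(H₁² + H₂²)`. -/
def maxControl (q p : Plane) : Plane :=
  WithLp.toLp 2 fun i => Z.fieldLift i q p / Real.sqrt (∑ j, Z.fieldLift j q p ^ 2)

/-- `(q, p)` is an extremal on `[0,T]` with constant `p₀`: a solution of the Hamiltonian system of
the maximized Hamiltonian, in the region `p ≠ 0` where this Hamiltonian is smooth,
contained in the zero level of the Hamiltonian. -/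
structure IsExtremal (T p₀ : ℝ) (q p : ℝ → Plane) : Prop where
  mem_dom : ∀ t ∈ Icc 0 T, q t ∈ Z.dom
  adjoint_ne_zero : ∀ t ∈ Icc 0 T, p t ≠ 0
  hasDeriv_state : ∀ t ∈ Icc 0 T,
    HasDerivWithinAt q (gradient (fun y => Z.maxHamiltonian p₀ (q t) y) (p t)) (Icc 0 T) t
  hasDeriv_adjoint : ∀ t ∈ Icc 0 T,
    HasDerivWithinAt p (-gradient (fun x => Z.maxHamiltonian p₀ x (p t)) (q t)) (Icc 0 T) t
  level : ∀ t ∈ Icc 0 T, Z.maxHamiltonian p₀ (q t) (p t) = 0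

end ZermeloSystem

/-- Let `f` be a map defined on the part `S ∩ D` of a subset `S` of a normed space. The point `x` of
`S` is a singularity of `f` if `f` is defined on `S` near `x`, Fréchet differentiable at `x` along
`S`, and its derivative, restricted to the tangent space of `S` at `x`, is not of maximal rank
(not onto `Y`). A derivative along `S` is unique on the tangent cone of `S`. -/
def IsSingularity {X Y : Type*} [NormedAddCommGroup X] [NormedSpace ℝ X] [NormedAddCommGroup Y]
    [NormedSpace ℝ Y] (f : X → Y) (D S : Set X) (x : X) : Prop :=
  x ∈ S ∧ D ∈ 𝓝[S] x ∧ ∃ f' : X →L[ℝ] Y, HasFDerivWithinAt f f' S x ∧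
    (Submodule.span ℝ (tangentConeAt ℝ S x)).map (f' : X →ₗ[ℝ] Y) ≠ ⊤

namespace ZermeloSystem

/-- `u` is a singularity of the fixed-time extremity mapping `v ↦ q(T, q₀, v)` on the
circle-valued controls. -/
def IsFixedTimeSingularity (Z : ZermeloSystem) (q₀ : Plane) (T : ℝ) (u : Control) : Prop :=
  IsSingularity (fun v : Control => Z.extremity q₀ T v) {v | Z.HasResponse q₀ v T}
    circleControls u

/-- `u` (on `[0,T]`) is a singularity of the free-time extremity mapping `(t, v) ↦ q(t, q₀, v)`
on times `t ≥ 0` and circle-valued controls. -/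
def IsFreeTimeSingularity (Z : ZermeloSystem) (q₀ : Plane) (T : ℝ) (u : Control) : Prop :=
  IsSingularity (fun x : ℝ × Control => Z.extremity q₀ x.1 x.2) {x | Z.HasResponse q₀ x.2 x.1}
    (Ici 0 ×ˢ circleControls) (T, u)

end ZermeloSystem

end

/-!
Fix the extremal `(q, p)` and its control `u`. Along the trajectories of nearby controls the end
point depends differentiably on the control, and its derivative is `ξ(T)`, where `ξ` solves the
equation linearized along `q`. The costate `p` solves the adjoint of that linear equation, so
`⟪p(T), ξ(T)⟫` is the integral of `⟪p, ∂_v velocity · δu⟫ = √(H₁² + H₂²) ⟪u, δu⟫`. On the unit circle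
`⟪u, v - u⟫ = -‖v - u‖² / 2`, so along circle-valued controls the end point moves in the
direction `p(T)` only to second order: `p(T)` is orthogonal to the image of the tangent space. This
holds for every `p₀`. With free time the image gains the direction `q'(T)`, and homogeneity of the
Hamiltonian in `p` gives `⟪p(T), q'(T)⟫ = H₀ + √(H₁² + H₂²) = -p₀`, which vanishes in the abnormal
case.

Differentiability needs no solution of the linearized equation. `inner_eq_integral_of_adjoint` is
the product rule for a Lipschitz curve and an adjoint solution; applied to the
difference of two trajectories and combined with Grönwall's inequality it gives the first variation
with quadratic remainder (`exists_inner_endpoint_sub_le`). Adjoint solutions ending in an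
orthonormal basis yield the derivative of the end point (`exists_endpoint_derivative`), and the
costate itself yields the orthogonality (`IsExtremal.exists_inner_endpoint_sub_le_sq`).
The derivative need not be compared with the second estimate: both describe derivatives along the
set of circle-valued controls, which are unique on its tangent cone (`IsSingularity.of_inner`).

Since controls are only measurable in time, existence and stability of responses are proved here
for integral equations (`exists_integral_solution`, `exists_norm_trajectory_sub_le`), after a cutoff
that makes the right-hand side smooth and compactly supported in state and control
(`ZermeloSystem.exists_cutoff`). For controls near `u` the cutoff is not felt, so that the extremity
mapping is locally the end point mapping of the truncated system (`IsResponse.exists_local_flow`).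
-/

/-! ### Integral equations and linear adjoint equations -/

/-- A continuous function on a compact interval extends continuously to the line. -/
lemma exists_continuous_eqOn_Icc {E : Type*} [TopologicalSpace E] {f : ℝ → E} {T : ℝ}
    (hT : 0 ≤ T) (hf : ContinuousOn f (Icc 0 T)) :
    ∃ g : ℝ → E, Continuous g ∧ EqOn g f (Icc 0 T) :=
  ⟨IccExtend hT ((Icc 0 T).domRestrict f), hf.domRestrict.Icc_extend', fun s hs => by
    rw [IccExtend_of_mem hT _ hs, domRestrict_apply]⟩

/-- Grönwall's inequality in integral form. -/
lemma le_mul_exp_of_le_add_mul_integral {φ : ℝ → ℝ} {T a K : ℝ} (hK : 0 ≤ K)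
    (hφ : ContinuousOn φ (Icc 0 T))
    (h : ∀ t ∈ Icc 0 T, φ t ≤ a + K * ∫ r in (0 : ℝ)..t, φ r) :
    ∀ t ∈ Icc 0 T, φ t ≤ a * Real.exp (K * t) := by
  intro t ht
  have hT : 0 ≤ T := ht.1.trans ht.2
  obtain ⟨φ', hcont, heq⟩ := exists_continuous_eqOn_Icc hT hφ
  have hint : ∀ s ∈ Icc 0 T, ∫ r in (0 : ℝ)..s, φ r = ∫ r in (0 : ℝ)..s, φ' r := fun s hs => by
    refine intervalIntegral.integral_congr fun r hr => (heq ?_).symm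
    rw [uIcc_of_le hs.1] at hr
    exact ⟨hr.1, hr.2.trans hs.2⟩
  have hder : ∀ s, HasDerivAt (fun s => a + K * ∫ r in (0 : ℝ)..s, φ' r) (K * φ' s) s := fun s =>
    ((hcont.integral_hasStrictDerivAt 0 s).hasDerivAt.const_mul K).const_add a
  have := le_gronwallBound_of_liminf_deriv_right_le (f := fun s => a + K * ∫ r in (0 : ℝ)..s, φ' r)
    (f' := fun s => K * φ' s) (δ := a) (K := K) (ε := 0) (a := 0) (b := T)
    (fun s _ => (hder s).continuousAt.continuousWithinAt)
    (fun s _ r hr => (hder s).hasDerivWithinAt.liminf_right_slope_le hr) (by simp)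
    (fun s hs => by
      have hs' := Ico_subset_Icc_self hs
      have := h s hs'
      rw [hint s hs', ← heq hs'] at this
      simpa using mul_le_mul_of_nonneg_left this hK) t ht
  rw [gronwallBound_ε0, sub_zero] at this
  refine le_trans ?_ this
  simpa only [hint t ht] using h t ht

/-- **Carathéodory–Picard existence.** An integral equation whose right-hand side is integrable
along continuous curves and Lipschitz in the state has a solution on the whole interval. -/
theorem exists_integral_solution {E : Type*} [NormedAddCommGroup E] [NormedSpace ℝ E]
    [CompleteSpace E] {f : ℝ → E → E} {T K : ℝ} (hT : 0 ≤ T) (hK : 0 ≤ K) (x₀ : E)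
    (hint : ∀ γ : ℝ → E, Continuous γ → IntervalIntegrable (fun r => f r (γ r)) volume 0 T)
    (hlip : ∀ᵐ r ∂(volume.restrict (Icc 0 T)), ∀ x y, ‖f r x - f r y‖ ≤ K * ‖x - y‖) :
    ∃ γ : ℝ → E, Continuous γ ∧ ∀ t ∈ Icc 0 T, γ t = x₀ + ∫ r in (0 : ℝ)..t, f r (γ r) := by
  -- With the weight `exp (-lam t)`, where `lam ≥ 2 K`, the Picard operator is a contraction
  -- on the whole interval.
  obtain ⟨lam, hlam0, hKlam⟩ : ∃ lam : ℝ, 0 < lam ∧ K * 2 ≤ lam :=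
    ⟨K * 2 + 1, by positivity, by simp⟩
  let ext : C(Icc 0 T, E) → ℝ → E := fun y r => Real.exp (lam * r) • IccExtend hT y r
  have hext : ∀ y, Continuous (ext y) := fun y =>
    (by fun_prop : Continuous fun r : ℝ => Real.exp (lam * r)).smul
      y.continuous.Icc_extend'
  have hintt : ∀ y, ∀ t ∈ Icc 0 T, IntervalIntegrable (fun r => f r (ext y r)) volume 0 t :=
    fun y t ht => (hint _ (hext y)).mono_set (by
      rw [uIcc_of_le ht.1, uIcc_of_le hT]; exact Icc_subset_Icc_right ht.2)
  have hprim : ∀ y, ContinuousOn (fun t => ∫ r in (0 : ℝ)..t, f r (ext y r)) (Icc 0 T) := fun y => by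
    have := intervalIntegral.continuousOn_primitive_interval' (hint _ (hext y))
      (left_mem_uIcc)
    rwa [uIcc_of_le hT] at this
  let Φ : C(Icc 0 T, E) → C(Icc 0 T, E) := fun y =>
    ⟨fun t => Real.exp (-(lam * t)) • (x₀ + ∫ r in (0 : ℝ)..t, f r (ext y r)), by
      refine (by fun_prop : Continuous fun t : Icc 0 T => Real.exp (-(lam * t))).smul
        (continuous_const.add (hprim y).domRestrict)⟩
  have hΦ : ContractingWith (1 / 2) Φ := by
    refine ⟨by rw [← NNReal.coe_lt_coe]; norm_num, LipschitzWith.of_dist_le_mul fun y z => ?_⟩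
    rw [ContinuousMap.dist_le (by positivity)]
    intro t
    have ht := t.2
    have hbound : ‖∫ r in (0 : ℝ)..t, (f r (ext y r) - f r (ext z r))‖
        ≤ ∫ r in (0 : ℝ)..t, K * dist y z * Real.exp (lam * r) := by
      refine intervalIntegral.norm_integral_le_of_norm_le ht.1 ?_
        (Continuous.intervalIntegrable (by fun_prop) _ _)
      rw [ae_restrict_iff' measurableSet_Icc] at hlip
      filter_upwards [hlip] with r hr hrt
      have hr' : r ∈ Icc 0 T := ⟨hrt.1.le, hrt.2.trans ht.2⟩
      refine (hr hr' _ _).trans ?_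
      rw [mul_assoc]
      gcongr
      simp only [ext]
      rw [← smul_sub, norm_smul, Real.norm_of_nonneg (Real.exp_pos _).le, mul_comm]
      gcongr
      rw [IccExtend_of_mem hT _ hr', IccExtend_of_mem hT _ hr', ← dist_eq_norm]
      exact ContinuousMap.dist_apply_le_dist _
    have hval : ∫ r in (0 : ℝ)..t, K * dist y z * Real.exp (lam * r)
        = K * dist y z * ((Real.exp (lam * t) - 1) / lam) := by
      rw [intervalIntegral.integral_const_mul, intervalIntegral.integral_comp_mul_left _ hlam0.ne',
        integral_exp]
      simp [div_eq_inv_mul]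
    rw [dist_eq_norm]
    have : Φ y t - Φ z t
        = Real.exp (-(lam * t)) • ∫ r in (0 : ℝ)..t, (f r (ext y r) - f r (ext z r)) := by
      rw [intervalIntegral.integral_sub (hintt y t ht) (hintt z t ht)]
      simp only [Φ, ContinuousMap.coe_mk, ← smul_sub]
      congr 1
      abel
    rw [this, norm_smul, Real.norm_of_nonneg (Real.exp_pos _).le]
    rw [hval] at hbound
    calc Real.exp (-(lam * t)) * ‖∫ r in (0 : ℝ)..t, (f r (ext y r) - f r (ext z r))‖
        ≤ Real.exp (-(lam * t)) * (K * dist y z * (Real.exp (lam * t) / lam)) := by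
          gcongr
          refine hbound.trans ?_
          gcongr
          simp
      _ = (K / lam) * dist y z := by
          rw [Real.exp_neg]
          field_simp
      _ ≤ _ := by
          gcongr
          rw [div_le_iff₀ hlam0]
          norm_num
          linarith
  have hfix : Φ (hΦ.fixedPoint Φ) = hΦ.fixedPoint Φ := hΦ.fixedPoint_isFixedPt
  refine ⟨ext (hΦ.fixedPoint Φ), hext _, fun t ht => ?_⟩
  have h1 := congrArg (fun y : C(Icc 0 T, E) => y ⟨t, ht⟩) hfix
  simp only [Φ, ContinuousMap.coe_mk] at h1
  have h2 : ext (hΦ.fixedPoint Φ) t = Real.exp (lam * t) • (hΦ.fixedPoint Φ) ⟨t, ht⟩ := by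
    simp only [ext]
    rw [IccExtend_of_mem hT _ ht]
  rw [h2, ← h1, smul_smul, ← Real.exp_add, add_neg_cancel, Real.exp_zero, one_smul]

/-- Global solvability of a linear equation with continuous coefficients, with prescribed value at
the right end point. -/
theorem exists_linear_solution_right {E : Type*} [NormedAddCommGroup E] [NormedSpace ℝ E]
    [CompleteSpace E] {A : ℝ → E →L[ℝ] E} {T : ℝ} (hT : 0 ≤ T) (hA : ContinuousOn A (Icc 0 T))
    (e : E) :
    ∃ π : ℝ → E, π T = e ∧ ∀ t ∈ Icc 0 T, HasDerivWithinAt π (A t (π t)) (Icc 0 T) t := by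
  obtain ⟨A', hcont, heq⟩ := exists_continuous_eqOn_Icc hT hA
  obtain ⟨C, hC⟩ := isCompact_Icc.exists_bound_of_continuousOn
    (f := fun r => A' (T - r)) (s := Icc 0 T) (by fun_prop)
  have hC0 : 0 ≤ C := (norm_nonneg _).trans (hC 0 ⟨le_rfl, hT⟩)
  -- Time is reversed: `x s = π (T - s)`.
  obtain ⟨x, hx, hxe⟩ := exists_integral_solution (f := fun r y => -(A' (T - r) y)) hT hC0 e
    (fun γ hγ => Continuous.intervalIntegrable (by fun_prop) _ _)
    (by
      filter_upwards [ae_restrict_mem measurableSet_Icc] with r hr y z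
      rw [neg_sub_neg, ← map_sub, norm_sub_rev y z]
      exact (ContinuousLinearMap.le_opNorm _ _).trans (by gcongr; exact hC r hr))
  have hcx : Continuous fun r => -(A' (T - r) (x r)) := by fun_prop
  have key : ∀ t, HasDerivAt (fun t => e + ∫ r in (0 : ℝ)..(T - t), -(A' (T - r) (x r)))
      (A' t (x (T - t))) t := fun t => by
    have h1 := (hcx.integral_hasStrictDerivAt 0 (T - t)).hasDerivAt
    have h2 := (h1.scomp t ((hasDerivAt_id t).const_sub T)).const_add e
    simpa using h2
  have hx' : ∀ t ∈ Icc 0 T, x (T - t) = e + ∫ r in (0 : ℝ)..(T - t), -(A' (T - r) (x r)) :=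
    fun t ht => hxe _ ⟨by linarith [ht.2], by linarith [ht.1]⟩
  refine ⟨fun t => x (T - t), ?_, fun t ht => ?_⟩
  · simp [hxe 0 ⟨le_rfl, hT⟩]
  · rw [← heq ht]
    exact (key t).hasDerivWithinAt.congr hx' (hx' t ht)

/-- A curve issued from `0` with bounded velocity `h` is paired with a solution of the adjoint
equation `π' = -A* π`: at the end point only the defect of `h` from the linear term contributes. -/
theorem inner_eq_integral_of_adjoint {E : Type*} [NormedAddCommGroup E] [InnerProductSpace ℝ E]
    [CompleteSpace E] {A : ℝ → E →L[ℝ] E} {T : ℝ} (hT : 0 ≤ T) (hA : ContinuousOn A (Icc 0 T))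
    {π δ h : ℝ → E} {M : ℝ}
    (hπ : ∀ t ∈ Icc 0 T, HasDerivWithinAt π (-(A t).adjoint (π t)) (Icc 0 T) t)
    (hh : IntervalIntegrable h volume 0 T) (hM : ∀ᵐ r ∂(volume.restrict (Icc 0 T)), ‖h r‖ ≤ M)
    (hδ : ∀ t ∈ Icc 0 T, δ t = ∫ r in (0 : ℝ)..t, h r) :
    inner ℝ (π T) (δ T) = ∫ r in (0 : ℝ)..T, inner ℝ (π r) (h r - A r (δ r)) := by
  have h0 : (0 : ℝ) ∈ Icc 0 T := ⟨le_rfl, hT⟩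
  have hπc : ContinuousOn π (Icc 0 T) := fun t ht => (hπ t ht).continuousWithinAt
  have hδc : ContinuousOn δ (Icc 0 T) := by
    have := intervalIntegral.continuousOn_primitive_interval' hh left_mem_uIcc
    rw [uIcc_of_le hT] at this
    exact this.congr hδ
  obtain ⟨P, hP⟩ := isCompact_Icc.exists_bound_of_continuousOn hπc
  obtain ⟨a, ha⟩ := isCompact_Icc.exists_bound_of_continuousOn hA
  have hP0 : 0 ≤ P := (norm_nonneg _).trans (hP 0 h0)
  have ha0 : 0 ≤ a := (norm_nonneg _).trans (ha 0 h0)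
  rw [ae_restrict_iff' measurableSet_Icc] at hM
  have hsub : ∀ {s t}, 0 ≤ s → s ≤ t → t ≤ T → uIcc s t ⊆ uIcc 0 T := fun hs hst ht => by
    rw [uIcc_of_le hst, uIcc_of_le hT]; exact Icc_subset_Icc hs ht
  have hadj : ContinuousOn (fun r => -(A r).adjoint (π r)) (Icc 0 T) :=
    (((ContinuousLinearMap.adjoint (𝕜 := ℝ) (E := E) (F := E)).continuous.comp_continuousOn
      hA).clm_apply hπc).neg
  have hcont : ContinuousOn (fun r => inner ℝ (π r) (A r (δ r))) (Icc 0 T) :=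
    hπc.inner (hA.clm_apply hδc)
  have hπh : IntervalIntegrable (fun r => inner ℝ (π r) (h r)) volume 0 T := by
    rw [intervalIntegrable_iff_integrableOn_Ioc_of_le hT] at hh ⊢
    refine (hh.norm.const_mul P).mono'
      (((hπc.mono Ioc_subset_Icc_self).aestronglyMeasurable measurableSet_Ioc).inner
        hh.aestronglyMeasurable) ?_
    filter_upwards [ae_restrict_mem measurableSet_Ioc] with r hr
    exact (norm_inner_le_norm _ _).trans (by gcongr; exact hP r ⟨hr.1.le, hr.2⟩)
  have hgint : IntervalIntegrable (fun r => inner ℝ (π r) (h r - A r (δ r))) volume 0 T := by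
    simp only [inner_sub_right]
    exact hπh.sub (hcont.intervalIntegrable_of_Icc hT)
  have hπlip : ∀ s ∈ Icc 0 T, ∀ t ∈ Icc 0 T, ‖π t - π s‖ ≤ a * P * ‖t - s‖ := fun s hs t ht =>
    (convex_Icc 0 T).norm_image_sub_le_of_norm_hasDerivWithin_le hπ (fun r hr => by
      rw [norm_neg]
      refine (ContinuousLinearMap.le_opNorm _ _).trans ?_
      rw [LinearIsometryEquiv.norm_map]
      gcongr
      exacts [ha r hr, hP r hr]) hs ht
  have hδsub : ∀ {s t}, 0 ≤ s → s ≤ t → t ≤ T → δ t - δ s = ∫ r in s..t, h r :=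
    fun {s t} hs hst ht => by
      rw [hδ t ⟨hs.trans hst, ht⟩, hδ s ⟨hs, hst.trans ht⟩,
        intervalIntegral.integral_interval_sub_left
          (hh.mono_set (hsub le_rfl (hs.trans hst) ht)) (hh.mono_set (hsub le_rfl hs (hst.trans ht)))]
  have hδlip : ∀ {s t}, 0 ≤ s → s ≤ t → t ≤ T → ‖δ t - δ s‖ ≤ M * (t - s) :=
    fun {s t} hs hst ht => by
      rw [hδsub hs hst ht, ← abs_of_nonneg (sub_nonneg.2 hst)]
      refine intervalIntegral.norm_integral_le_of_norm_le_const_ae ?_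
      filter_upwards [hM] with r hr hrt
      rw [uIoc_of_le hst] at hrt
      exact hr ⟨hs.trans hrt.1.le, hrt.2.trans ht⟩
  have hM0 : 0 ≤ M ∨ T = 0 := by
    rcases hT.eq_or_lt with hT0 | hT0
    · exact Or.inr hT0.symm
    · refine Or.inl ?_
      have := (norm_nonneg _).trans (hδlip le_rfl hT le_rfl)
      rw [sub_zero] at this
      exact nonneg_of_mul_nonneg_left this hT0
  rcases hM0 with hM0 | rfl
  swap
  · simp [hδ 0 h0]
  set φ : ℝ → ℝ := fun t =>
    inner ℝ (π t) (δ t) - ∫ r in (0 : ℝ)..t, inner ℝ (π r) (h r - A r (δ r)) with hφ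
  -- The increments of the difference of the two sides are quadratically small.
  have hquad : ∀ s t, 0 ≤ s → s ≤ t → t ≤ T → ‖φ t - φ s‖ ≤ 2 * (a * P * M) * (t - s) * (t - s) := by
    intro s t hs hst ht
    have hIcc : Icc s t ⊆ Icc 0 T := Icc_subset_Icc hs ht
    have e1 : inner ℝ (π t - π s) (δ t) = ∫ r in s..t, inner ℝ (-(A r).adjoint (π r)) (δ t) := by
      rw [inner_sub_left]
      symm
      refine intervalIntegral.integral_eq_sub_of_hasDerivAt_of_le (f := fun r => inner ℝ (π r) (δ t))
        hst ((hπc.mono hIcc).inner continuousOn_const) (fun r hr => ?_)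
        (((hadj.mono hIcc).inner continuousOn_const).intervalIntegrable_of_Icc hst)
      have hr' := hIcc (Ioo_subset_Icc_self hr)
      have := ((hπ r hr').hasDerivAt (Icc_mem_nhds (hs.trans_lt hr.1) (hr.2.trans_le ht))).inner ℝ
        (hasDerivAt_const r (δ t))
      simpa using this
    have e2 : inner ℝ (π s) (δ t - δ s) = ∫ r in s..t, inner ℝ (π s) (h r) := by
      rw [hδsub hs hst ht]
      exact ((innerSL ℝ (π s)).intervalIntegral_comp_comm (hh.mono_set (hsub hs hst ht))).symm
    have i1 : IntervalIntegrable (fun r => inner ℝ (-(A r).adjoint (π r)) (δ t)) volume s t :=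
      ((hadj.mono hIcc).inner continuousOn_const).intervalIntegrable_of_Icc hst
    have i2 : IntervalIntegrable (fun r => inner ℝ (π s) (h r)) volume s t := by
      have := hh.mono_set (hsub hs hst ht)
      exact ⟨(innerSL ℝ (π s)).integrable_comp this.1, (innerSL ℝ (π s)).integrable_comp this.2⟩
    have e3 : φ t - φ s = ∫ r in s..t, (inner ℝ (-(A r).adjoint (π r)) (δ t) + inner ℝ (π s) (h r)
        - inner ℝ (π r) (h r - A r (δ r))) := by
      rw [intervalIntegral.integral_sub (i1.add i2) (hgint.mono_set (hsub hs hst ht)),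
        intervalIntegral.integral_add i1 i2, ← e1, ← e2,
        ← intervalIntegral.integral_interval_sub_left
          (hgint.mono_set (hsub le_rfl (hs.trans hst) ht))
          (hgint.mono_set (hsub le_rfl hs (hst.trans ht)))]
      simp only [hφ, inner_sub_left, inner_sub_right]
      ring
    rw [e3]
    nth_rewrite 2 [← abs_of_nonneg (sub_nonneg.2 hst)]
    refine intervalIntegral.norm_integral_le_of_norm_le_const_ae ?_
    filter_upwards [hM] with r hr hrt
    rw [uIoc_of_le hst] at hrt
    have hr' : r ∈ Icc 0 T := ⟨hs.trans hrt.1.le, hrt.2.trans ht⟩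
    have hs' : s ∈ Icc 0 T := ⟨hs, hst.trans ht⟩
    have : inner ℝ (-(A r).adjoint (π r)) (δ t) + inner ℝ (π s) (h r)
        - inner ℝ (π r) (h r - A r (δ r))
        = -inner ℝ (π r) (A r (δ t - δ r)) - inner ℝ (π r - π s) (h r) := by
      rw [inner_neg_left, ContinuousLinearMap.adjoint_inner_left, map_sub]
      simp only [inner_sub_left, inner_sub_right]
      ring
    rw [this]
    have b1 : ‖inner ℝ (π r) (A r (δ t - δ r))‖ ≤ P * (a * (M * (t - s))) := by
      refine (norm_inner_le_norm _ _).trans ?_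
      refine mul_le_mul (hP r hr') ?_ (norm_nonneg _) hP0
      refine (ContinuousLinearMap.le_opNorm _ _).trans ?_
      refine mul_le_mul (ha r hr') ?_ (norm_nonneg _) ha0
      refine (hδlip hr'.1 hrt.2 ht).trans ?_
      gcongr
      exact hrt.1.le
    have b2 : ‖inner ℝ (π r - π s) (h r)‖ ≤ a * P * (t - s) * M := by
      refine (norm_inner_le_norm _ _).trans ?_
      refine mul_le_mul ((hπlip s hs' r hr').trans ?_) (hr hr') (norm_nonneg _)
        (by have := sub_nonneg.2 hst; positivity)
      rw [Real.norm_of_nonneg (sub_nonneg.2 hrt.1.le)]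
      gcongr
      exact hrt.2
    refine (norm_sub_le _ _).trans ?_
    rw [norm_neg]
    linarith
  have hφc : ContinuousOn φ (Icc 0 T) := by
    have := intervalIntegral.continuousOn_primitive_interval' hgint left_mem_uIcc
    rw [uIcc_of_le hT] at this
    exact (hπc.inner hδc).sub this
  have hconst := constant_of_has_deriv_right_zero hφc (fun s hs => by
    have hz : HasDerivWithinAt φ 0 (Icc s T) s := by
      rw [hasDerivWithinAt_iff_isLittleO]
      simp only [smul_zero, sub_zero]
      have hb : (fun t => φ t - φ s) =O[𝓝[Icc s T] s] fun t => (t - s) * (t - s) := by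
        refine Asymptotics.IsBigO.of_bound (2 * (a * P * M)) ?_
        filter_upwards [self_mem_nhdsWithin] with t ht
        refine (hquad s t hs.1 ht.1 ht.2).trans ?_
        rw [Real.norm_of_nonneg (mul_self_nonneg _), mul_assoc]
      refine hb.trans_isLittleO ?_
      have : (fun t => t - s) =o[𝓝[Icc s T] s] (fun _ => (1 : ℝ)) := by
        rw [Asymptotics.isLittleO_one_iff]
        have : Filter.Tendsto (fun t => t - s) (𝓝[Icc s T] s) (𝓝 (s - s)) :=
          ((continuous_id.sub continuous_const).tendsto s).mono_left nhdsWithin_le_nhds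
        simpa using this
      simpa using this.mul_isBigO (Asymptotics.isBigO_refl (fun t => t - s) _)
    exact hz.mono_of_mem_nhdsWithin (Icc_mem_nhdsGE_of_mem ⟨le_rfl, hs.2⟩)) T ⟨hT, le_rfl⟩
  have hz : φ 0 = 0 := by simp [hφ, hδ 0 h0]
  rw [hz] at hconst
  exact sub_eq_zero.1 hconst

/-! ### Compactly supported control systems -/

lemma restrict_Icc_le_restrict_Ici (T : ℝ) :
    (volume : Measure ℝ).restrict (Icc 0 T) ≤ volume.restrict (Ici 0) :=
  Measure.restrict_mono Icc_subset_Ici_self le_rfl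

/-- `γ` is the Carathéodory solution on `[0,t]` of `γ' = g(γ, v)` issued from `x₀`, in integral
form. -/
def IsTrajectory {E V : Type*} [NormedAddCommGroup E] [NormedSpace ℝ E] (g : E × V → E) (x₀ : E)
    (v : ℝ → V) (t : ℝ) (γ : ℝ → E) : Prop :=
  ContinuousOn γ (Icc 0 t) ∧ ∀ s ∈ Icc 0 t, γ s = x₀ + ∫ r in (0 : ℝ)..s, g (γ r, v r)

namespace IsTrajectory

variable {E V : Type*} [NormedAddCommGroup E] [NormedSpace ℝ E] {g : E × V → E}
  {x₀ : E} {v : ℝ → V} {t : ℝ} {γ : ℝ → E}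

lemma mono (h : IsTrajectory g x₀ v t γ) {s : ℝ} (hs : s ≤ t) : IsTrajectory g x₀ v s γ :=
  ⟨h.1.mono (Icc_subset_Icc_right hs), fun r hr => h.2 r ⟨hr.1, hr.2.trans hs⟩⟩

end IsTrajectory

section ControlledEquation

variable {E V : Type*} [NormedAddCommGroup E] [NormedAddCommGroup V]

lemma exists_lipschitz_const [NormedSpace ℝ E] [NormedSpace ℝ V] {g : V → E}
    (hg : ContDiff ℝ 1 g) (hc : HasCompactSupport g) :
    ∃ L : ℝ, 0 ≤ L ∧ ∀ z z', ‖g z' - g z‖ ≤ L * ‖z' - z‖ := by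
  obtain ⟨C, hC⟩ := hg.lipschitzWith_of_hasCompactSupport hc one_ne_zero
  exact ⟨C, C.2, fun z z' => hC.norm_sub_le z' z⟩

/-- A compactly supported `C²` map is approximated to second order by its derivative, uniformly. -/
lemma exists_taylor_const [NormedSpace ℝ E] [NormedSpace ℝ V] {g : V → E}
    (hg : ContDiff ℝ 2 g) (hc : HasCompactSupport g) :
    ∃ C : ℝ, 0 ≤ C ∧ ∀ z z', ‖g z' - g z - fderiv ℝ g z (z' - z)‖ ≤ C * ‖z' - z‖ ^ 2 := by
  obtain ⟨C, hC0, hC⟩ := exists_lipschitz_const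
    (hg.fderiv_right (m := 1) (by norm_num)) (hc.fderiv ℝ)
  refine ⟨C, hC0, fun z z' => ?_⟩
  have := (convex_segment z z').norm_image_sub_le_of_norm_fderiv_le' (f := g) (𝕜 := ℝ)
    (φ := fderiv ℝ g z) (C := C * ‖z' - z‖)
    (fun x _ => (hg.differentiable (by norm_num)).differentiableAt) (fun x hx => by
      refine (hC z x).trans ?_
      gcongr
      exact norm_sub_le_of_mem_segment hx) (left_mem_segment ℝ z z') (right_mem_segment ℝ z z')
  rwa [mul_assoc, ← sq] at this


lemma aestronglyMeasurable_velocity {g : E × V → E} {v : ℝ → V} {t : ℝ} {γ : ℝ → E}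
    (hg : Continuous g) (hv : AEStronglyMeasurable v (volume.restrict (Ici 0)))
    (hγ : ContinuousOn γ (Icc 0 t)) :
    AEStronglyMeasurable (fun r => g (γ r, v r)) (volume.restrict (Icc 0 t)) :=
  hg.comp_aestronglyMeasurable ((hγ.aestronglyMeasurable measurableSet_Icc).prodMk
    (hv.mono_measure (restrict_Icc_le_restrict_Ici t)))

lemma norm_prodMk_sub_le (x y : E) (v w : V) : ‖(x, v) - (y, w)‖ ≤ ‖x - y‖ + ‖v - w‖ := by
  rw [Prod.mk_sub_mk, Prod.norm_mk]
  exact max_le_add_of_nonneg (norm_nonneg _) (norm_nonneg _)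

lemma intervalIntegrable_velocity {g : E × V → E} {v : ℝ → V} {t M : ℝ} {γ : ℝ → E} (ht : 0 ≤ t)
    (hg : Continuous g) (hM : ∀ z, ‖g z‖ ≤ M)
    (hv : AEStronglyMeasurable v (volume.restrict (Ici 0)))
    (hγ : ContinuousOn γ (Icc 0 t)) :
    IntervalIntegrable (fun r => g (γ r, v r)) volume 0 t := by
  rw [intervalIntegrable_iff_integrableOn_Icc_of_le ht]
  exact (integrable_const M).mono' (aestronglyMeasurable_velocity hg hv hγ)
    (Filter.Eventually.of_forall fun r => hM _)

variable [NormedSpace ℝ E] [NormedSpace ℝ V]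

/-- Global existence for a compactly supported control system and a measurable control. -/
lemma exists_isTrajectory [CompleteSpace E] {g : E × V → E} (hg : ContDiff ℝ 2 g)
    (hc : HasCompactSupport g) (x₀ : E) {v : ℝ → V}
    (hv : AEStronglyMeasurable v (volume.restrict (Ici 0))) {T : ℝ} (hT : 0 ≤ T) :
    ∃ γ, IsTrajectory g x₀ v T γ := by
  obtain ⟨M, hM⟩ := hc.exists_bound_of_continuous hg.continuous
  obtain ⟨L, hL0, hL⟩ := exists_lipschitz_const (hg.of_le (by norm_num)) hc
  obtain ⟨γ, hγ, hγe⟩ := exists_integral_solution (f := fun r x => g (x, v r)) hT hL0 x₀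
    (fun γ hγ => intervalIntegrable_velocity hT hg.continuous hM hv hγ.continuousOn)
    (Filter.Eventually.of_forall fun r x y => by
      refine (hL _ _).trans ?_
      gcongr
      simp [Prod.norm_mk])
  exact ⟨γ, hγ.continuousOn, hγe⟩

/-- Trajectories depend Lipschitz continuously on the control, in the uniform norms. -/
lemma exists_norm_trajectory_sub_le {g : E × V → E} (hg : ContDiff ℝ 2 g)
    (hc : HasCompactSupport g) (T : ℝ) :
    ∃ C : ℝ, 0 ≤ C ∧ ∀ (x₀ : E) (u v : ℝ → V) (ε t : ℝ) (γ η : ℝ → E), t ≤ T → 0 ≤ ε →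
      AEStronglyMeasurable u (volume.restrict (Ici 0)) →
      AEStronglyMeasurable v (volume.restrict (Ici 0)) →
      (∀ᵐ r ∂(volume.restrict (Ici 0)), ‖v r - u r‖ ≤ ε) →
      IsTrajectory g x₀ u t γ → IsTrajectory g x₀ v t η →
      ∀ s ∈ Icc 0 t, ‖η s - γ s‖ ≤ C * ε := by
  obtain ⟨M, hM⟩ := hc.exists_bound_of_continuous hg.continuous
  obtain ⟨L, hL0, hL⟩ := exists_lipschitz_const (hg.of_le (by norm_num)) hc
  refine ⟨L * |T| * Real.exp (L * |T|), by positivity, ?_⟩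
  intro x₀ u v ε t γ η htT hε0 hu hv hε hγ hη s hs
  have ht : 0 ≤ t := hs.1.trans hs.2
  have hle : ∀ r ∈ Icc 0 t, r ≤ |T| := fun r hr => hr.2.trans (htT.trans (le_abs_self T))
  rw [ae_restrict_iff' measurableSet_Ici] at hε
  have key : ∀ s ∈ Icc 0 t, ‖η s - γ s‖ ≤ L * |T| * ε + L * ∫ r in (0 : ℝ)..s, ‖η r - γ r‖ := by
    intro s hs
    have hcs : ContinuousOn (fun r => ‖η r - γ r‖) (Icc 0 s) :=
      ((hη.1.sub hγ.1).norm).mono (Icc_subset_Icc_right hs.2)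
    rw [hη.2 s hs, hγ.2 s hs, add_sub_add_left_eq_sub, ← intervalIntegral.integral_sub
      (intervalIntegrable_velocity hs.1 hg.continuous hM hv (hη.mono hs.2).1)
      (intervalIntegrable_velocity hs.1 hg.continuous hM hu (hγ.mono hs.2).1)]
    have hi : IntervalIntegrable (fun r => ‖η r - γ r‖) volume 0 s :=
      hcs.intervalIntegrable_of_Icc hs.1
    calc _ ≤ ∫ r in (0 : ℝ)..s, (L * ε + L * ‖η r - γ r‖) := by
          refine intervalIntegral.norm_integral_le_of_norm_le hs.1 ?_
            (intervalIntegrable_const.add (hi.const_mul L))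
          filter_upwards [hε] with r hr hrs
          refine (hL _ _).trans ?_
          rw [← mul_add, add_comm ε]
          gcongr
          exact (norm_prodMk_sub_le _ _ _ _).trans (by gcongr; exact hr hrs.1.le)
      _ = s * (L * ε) + L * ∫ r in (0 : ℝ)..s, ‖η r - γ r‖ := by
          rw [intervalIntegral.integral_add intervalIntegrable_const (hi.const_mul L),
            intervalIntegral.integral_const_mul]
          simp [mul_left_comm]
      _ ≤ _ := by
          have : s * (L * ε) ≤ |T| * (L * ε) := by gcongr; exact hle s hs
          linarith
  calc ‖η s - γ s‖ ≤ L * |T| * ε * Real.exp (L * s) :=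
        le_mul_exp_of_le_add_mul_integral hL0 ((hη.1.sub hγ.1).norm) key s hs
    _ ≤ L * |T| * ε * Real.exp (L * |T|) := by gcongr; exact hle s hs
    _ = _ := by ring

end ControlledEquation

section EndPoint

variable {E V : Type*} [NormedAddCommGroup E] [InnerProductSpace ℝ E] [CompleteSpace E]
  [NormedAddCommGroup V] [InnerProductSpace ℝ V]

/-- First variation of the end point against a solution `π` of the adjoint equation along the
reference trajectory `q`, with a quadratic remainder. -/
lemma exists_inner_endpoint_sub_le {g : E × V → E} (hg : ContDiff ℝ 2 g)
    (hc : HasCompactSupport g) {T : ℝ} (hT : 0 ≤ T) {x₀ : E} {u us : ℝ → V} {q π : ℝ → E}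
    (hu : AEStronglyMeasurable u (volume.restrict (Ici 0)))
    (hus : ContinuousOn us (Icc 0 T)) (huus : ∀ᵐ r ∂(volume.restrict (Icc 0 T)), u r = us r)
    (hq : IsTrajectory g x₀ u T q)
    (hπ : ∀ t ∈ Icc 0 T, HasDerivWithinAt π
      (-(fderiv ℝ g (q t, us t) ∘L ContinuousLinearMap.inl ℝ E V).adjoint (π t)) (Icc 0 T) t) :
    ∃ C : ℝ, ∀ (v : ℝ → V) (ε : ℝ) (γ : ℝ → E), 0 ≤ ε →
      AEStronglyMeasurable v (volume.restrict (Ici 0)) →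
      (∀ᵐ r ∂(volume.restrict (Ici 0)), ‖v r - u r‖ ≤ ε) → IsTrajectory g x₀ v T γ →
      |inner ℝ (π T) (γ T - q T) -
        ∫ r in (0 : ℝ)..T, inner ℝ (π r) (fderiv ℝ g (q r, us r) (0, v r - u r))| ≤ C * ε ^ 2 := by
  obtain ⟨M, hM⟩ := hc.exists_bound_of_continuous hg.continuous
  obtain ⟨C₁, hC₁, hdist⟩ := exists_norm_trajectory_sub_le hg hc T
  obtain ⟨C₂, hC₂, htaylor⟩ := exists_taylor_const hg hc
  have hπc : ContinuousOn π (Icc 0 T) := fun t ht => (hπ t ht).continuousWithinAt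
  obtain ⟨P, hP⟩ := isCompact_Icc.exists_bound_of_continuousOn hπc
  have hD : ContinuousOn (fun t => fderiv ℝ g (q t, us t)) (Icc 0 T) :=
    (hg.continuous_fderiv (by norm_num)).comp_continuousOn (hq.1.prodMk hus)
  have hA : ContinuousOn (fun t => fderiv ℝ g (q t, us t) ∘L ContinuousLinearMap.inl ℝ E V)
      (Icc 0 T) := hD.clm_comp continuousOn_const
  obtain ⟨b, hb⟩ := isCompact_Icc.exists_bound_of_continuousOn (E := E × V →L[ℝ] E) hD
  refine ⟨P * (C₂ * (C₁ + 1) ^ 2) * T, fun v ε γ hε0 hv hε hγ => ?_⟩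
  have hdγ := hdist x₀ u v ε T q γ le_rfl hε0 hu hv hε hq hγ
  have hiγ := intervalIntegrable_velocity hT hg.continuous hM hv hγ.1
  have hiq := intervalIntegrable_velocity hT hg.continuous hM hu hq.1
  have hIcc : ∀ {s}, s ∈ Icc 0 T → uIcc 0 s ⊆ uIcc 0 T := fun hs => by
    rw [uIcc_of_le hT, uIcc_of_le hs.1]; exact Icc_subset_Icc_right hs.2
  have hmain := inner_eq_integral_of_adjoint (δ := fun t => γ t - q t)
    (h := fun r => g (γ r, v r) - g (q r, u r)) (M := M + M) hT hA hπ (hiγ.sub hiq)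
    (Filter.Eventually.of_forall fun r => (norm_sub_le _ _).trans (add_le_add (hM _) (hM _)))
    (fun t ht => by
      rw [hγ.2 t ht, hq.2 t ht, add_sub_add_left_eq_sub, intervalIntegral.integral_sub
        (hiγ.mono_set (hIcc ht)) (hiq.mono_set (hIcc ht))])
  have hMicc := restrict_Icc_le_restrict_Ici T
  have hε' : ∀ᵐ r ∂(volume.restrict (Icc 0 T)), ‖v r - u r‖ ≤ ε := ae_mono hMicc hε
  have hvm := hv.mono_measure hMicc
  have hum := hu.mono_measure hMicc
  have hπm := hπc.aestronglyMeasurable (μ := volume) measurableSet_Icc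
  have hi1 : IntervalIntegrable
      (fun r => inner ℝ (π r) (fderiv ℝ g (q r, us r) (0, v r - u r))) volume 0 T := by
    rw [intervalIntegrable_iff_integrableOn_Icc_of_le hT]
    refine (integrable_const (P * (b * ε))).mono' (hπm.inner ?_) ?_
    · have hΨ : Continuous fun y : (E × V) × V => fderiv ℝ g y.1 (0, y.2) :=
        ((hg.continuous_fderiv (by norm_num)).comp continuous_fst).clm_apply (by fun_prop)
      exact hΨ.comp_aestronglyMeasurable
        (((hq.1.prodMk hus).aestronglyMeasurable measurableSet_Icc).prodMk (hvm.sub hum))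
    · filter_upwards [hε', ae_restrict_mem measurableSet_Icc] with r hr hrt
      refine (norm_inner_le_norm _ _).trans ?_
      refine mul_le_mul (hP r hrt) ?_ (norm_nonneg _) ((norm_nonneg _).trans (hP r hrt))
      refine (ContinuousLinearMap.le_opNorm _ _).trans ?_
      refine mul_le_mul (hb r hrt) ?_ (norm_nonneg _) ((norm_nonneg _).trans (hb r hrt))
      simpa [Prod.norm_mk] using hr
  have hi2 : IntervalIntegrable (fun r => inner ℝ (π r) (g (γ r, v r) - g (q r, u r) -
      (fderiv ℝ g (q r, us r) ∘L ContinuousLinearMap.inl ℝ E V) (γ r - q r))) volume 0 T := by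
    rw [intervalIntegrable_iff_integrableOn_Icc_of_le hT] at hiγ hiq ⊢
    have hAδ := hA.clm_apply (hγ.1.sub hq.1)
    obtain ⟨c, hc'⟩ := isCompact_Icc.exists_bound_of_continuousOn hAδ
    refine (integrable_const (P * (M + M + c))).mono' (hπm.inner
      ((hiγ.1.sub hiq.1).sub (hAδ.aestronglyMeasurable measurableSet_Icc))) ?_
    filter_upwards [ae_restrict_mem measurableSet_Icc] with r hrt
    refine (norm_inner_le_norm _ _).trans ?_
    refine mul_le_mul (hP r hrt) ?_ (norm_nonneg _) ((norm_nonneg _).trans (hP r hrt))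
    refine (norm_sub_le _ _).trans (add_le_add ?_ (hc' r hrt))
    exact (norm_sub_le _ _).trans (add_le_add (hM _) (hM _))
  rw [hmain, ← intervalIntegral.integral_sub hi2 hi1, ← Real.norm_eq_abs]
  refine (intervalIntegral.norm_integral_le_of_norm_le_const_ae
    (C := P * (C₂ * (C₁ + 1) ^ 2 * ε ^ 2)) ?_).trans (le_of_eq ?_)
  swap
  · rw [sub_zero, abs_of_nonneg hT]; ring
  rw [ae_restrict_iff' measurableSet_Icc] at hε' huus
  filter_upwards [hε', huus] with r hr hur hrt
  rw [uIoc_of_le hT] at hrt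
  have hrT : r ∈ Icc 0 T := ⟨hrt.1.le, hrt.2⟩
  have hP0 := (norm_nonneg _).trans (hP r hrT)
  rw [← inner_sub_right]
  refine (norm_inner_le_norm _ _).trans ?_
  refine mul_le_mul (hP r hrT) ?_ (norm_nonneg _) hP0
  have hsplit : g (γ r, v r) - g (q r, u r) -
      (fderiv ℝ g (q r, us r) ∘L ContinuousLinearMap.inl ℝ E V) (γ r - q r) -
      fderiv ℝ g (q r, us r) (0, v r - u r) =
      g (γ r, v r) - g (q r, u r) - fderiv ℝ g (q r, u r) ((γ r, v r) - (q r, u r)) := by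
    rw [← hur hrT, sub_sub, ContinuousLinearMap.comp_apply, ContinuousLinearMap.inl_apply,
      ← map_add, Prod.mk_add_mk, add_zero, zero_add, Prod.mk_sub_mk]
  rw [hsplit, mul_assoc, ← mul_pow]
  refine (htaylor _ _).trans ?_
  gcongr
  refine (norm_prodMk_sub_le _ _ _ _).trans ?_
  have h1 := hdγ r hrT
  have h2 := hr hrT
  linarith

end EndPoint

/-! ### Differentiability of the end point with respect to the control -/

lemma Control.ae_norm_le (u : Control) :
    ∀ᵐ r ∂(volume.restrict (Ici (0 : ℝ))), ‖(u : ℝ → Plane) r‖ ≤ ‖u‖ := by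
  have h := ae_le_lpNorm_exponent_top (Lp.memLp u)
  rwa [← toReal_eLpNorm (Lp.memLp u).aestronglyMeasurable, ← Lp.norm_def] at h

lemma Control.ae_norm_sub_le (u v : Control) :
    ∀ᵐ r ∂(volume.restrict (Ici (0 : ℝ))), ‖(v : ℝ → Plane) r - (u : ℝ → Plane) r‖ ≤ ‖v - u‖ := by
  filter_upwards [(v - u).ae_norm_le, Lp.coeFn_sub v u] with r hr hs
  rwa [hs] at hr

lemma Control.aestronglyMeasurable (u : Control) :
    AEStronglyMeasurable (u : ℝ → Plane) (volume.restrict (Ici (0 : ℝ))) :=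
  Lp.aestronglyMeasurable u

/-- A continuous curve on `[0,T]` defines by integration a bounded functional on controls. -/
lemma exists_integral_functional {b : ℝ → Plane} {T : ℝ} (hT : 0 ≤ T)
    (hb : ContinuousOn b (Icc 0 T)) :
    ∃ ℓ : Control →L[ℝ] ℝ, ∀ w v : Control,
      ℓ (v - w) = ∫ r in (0 : ℝ)..T, inner ℝ (b r) ((v : ℝ → Plane) r - (w : ℝ → Plane) r) := by
  have hmono := restrict_Icc_le_restrict_Ici T
  obtain ⟨B, hB⟩ := isCompact_Icc.exists_bound_of_continuousOn hb
  have hB0 : 0 ≤ B := (norm_nonneg _).trans (hB 0 ⟨le_rfl, hT⟩)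
  have hbound : ∀ w : Control, ∀ᵐ r ∂(volume.restrict (Icc 0 T)),
      ‖inner ℝ (b r) ((w : ℝ → Plane) r)‖ ≤ B * ‖w‖ := fun w => by
    filter_upwards [ae_mono hmono w.ae_norm_le, ae_restrict_mem measurableSet_Icc] with r hr hrT
    exact (norm_inner_le_norm _ _).trans (mul_le_mul (hB r hrT) hr (norm_nonneg _) hB0)
  have hint : ∀ w : Control,
      Integrable (fun r => inner ℝ (b r) ((w : ℝ → Plane) r)) (volume.restrict (Icc 0 T)) :=
    fun w => (integrable_const (B * ‖w‖)).mono'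
      ((hb.aestronglyMeasurable measurableSet_Icc).inner (w.aestronglyMeasurable.mono_measure hmono))
      (hbound w)
  have hto : ∀ f : ℝ → ℝ, ∫ r in (0 : ℝ)..T, f r = ∫ r in Icc 0 T, f r := fun f => by
    rw [intervalIntegral.integral_of_le hT, integral_Icc_eq_integral_Ioc]
  let L : Control →ₗ[ℝ] ℝ :=
    { toFun := fun w => ∫ r in Icc 0 T, inner ℝ (b r) ((w : ℝ → Plane) r)
      map_add' := fun v w => by
        rw [← integral_add (hint v) (hint w)]
        refine integral_congr_ae ?_
        filter_upwards [ae_mono hmono (Lp.coeFn_add v w)] with r hr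
        rw [hr, Pi.add_apply, inner_add_right]
      map_smul' := fun c w => by
        rw [RingHom.id_apply, smul_eq_mul, ← integral_const_mul]
        refine integral_congr_ae ?_
        filter_upwards [ae_mono hmono (Lp.coeFn_smul c w)] with r hr
        rw [hr, Pi.smul_apply, inner_smul_right] }
  refine ⟨L.mkContinuous (B * T) fun w => ?_, fun w v => ?_⟩
  · have := norm_integral_le_of_norm_le_const (hbound w)
    refine this.trans (le_of_eq ?_)
    simp [measureReal_def, hT]
    ring
  · rw [hto]
    refine integral_congr_ae ?_
    filter_upwards [ae_mono hmono (Lp.coeFn_sub v w)] with r hr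
    rw [hr, Pi.sub_apply]

/-- The end point map of a compactly supported control system is differentiable, with a quadratic
remainder. The coordinates of the derivative are obtained from the adjoint solutions with terminal
values in an orthonormal basis. -/
lemma exists_endpoint_derivative {g : Plane × Plane → Plane} (hg : ContDiff ℝ 2 g)
    (hc : HasCompactSupport g) {T : ℝ} (hT : 0 ≤ T) {x₀ : Plane} {u : Control} {us q : ℝ → Plane}
    (hus : ContinuousOn us (Icc 0 T))
    (huus : ∀ᵐ r ∂(volume.restrict (Icc 0 T)), (u : ℝ → Plane) r = us r)
    (hq : IsTrajectory g x₀ u T q) :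
    ∃ (f' : Control →L[ℝ] Plane) (C : ℝ), ∀ (v : Control) (γ : ℝ → Plane),
      IsTrajectory g x₀ v T γ → ‖γ T - q T - f' (v - u)‖ ≤ C * ‖v - u‖ ^ 2 := by
  let e := EuclideanSpace.basisFun (Fin 2) ℝ
  have hD : ContinuousOn (fun t => fderiv ℝ g (q t, us t)) (Icc 0 T) :=
    (hg.continuous_fderiv (by norm_num)).comp_continuousOn (hq.1.prodMk hus)
  have hadj := (ContinuousLinearMap.adjoint (𝕜 := ℝ) (E := Plane) (F := Plane)).continuous
  have hcoord : ∀ j, ∃ (ℓ : Control →L[ℝ] ℝ) (C : ℝ), ∀ (v : Control) (γ : ℝ → Plane),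
      IsTrajectory g x₀ v T γ → |inner ℝ (e j) (γ T - q T) - ℓ (v - u)| ≤ C * ‖v - u‖ ^ 2 := by
    intro j
    have hA : ContinuousOn (fun t =>
        -(fderiv ℝ g (q t, us t) ∘L ContinuousLinearMap.inl ℝ Plane Plane).adjoint) (Icc 0 T) :=
      (hadj.comp_continuousOn (hD.clm_comp continuousOn_const)).neg
    obtain ⟨π, hπT, hπ⟩ := exists_linear_solution_right hT hA (e j)
    obtain ⟨C, hC⟩ := exists_inner_endpoint_sub_le hg hc hT u.aestronglyMeasurable hus huus hq hπ
    have hπc : ContinuousOn π (Icc 0 T) := fun t ht => (hπ t ht).continuousWithinAt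
    obtain ⟨ℓ, hℓ⟩ := exists_integral_functional hT (b := fun t =>
      (fderiv ℝ g (q t, us t) ∘L ContinuousLinearMap.inr ℝ Plane Plane).adjoint (π t))
      ((hadj.comp_continuousOn (hD.clm_comp continuousOn_const)).clm_apply hπc)
    refine ⟨ℓ, C, fun v γ hγ => ?_⟩
    have := hC v ‖v - u‖ γ (norm_nonneg _) v.aestronglyMeasurable (Control.ae_norm_sub_le u v) hγ
    rw [hπT] at this
    rw [hℓ]
    simpa only [ContinuousLinearMap.adjoint_inner_left, ContinuousLinearMap.comp_apply,
      ContinuousLinearMap.inr_apply] using this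
  choose ℓ C hℓ using hcoord
  refine ⟨∑ j, (ℓ j).smulRight (e j), ∑ j, C j, fun v γ hγ => ?_⟩
  have : γ T - q T - (∑ j, (ℓ j).smulRight (e j)) (v - u)
      = ∑ j, (inner ℝ (e j) (γ T - q T) - ℓ j (v - u)) • e j := by
    conv_lhs => rw [← e.sum_repr' (γ T - q T)]
    rw [_root_.sum_apply, ← Finset.sum_sub_distrib]
    simp only [ContinuousLinearMap.smulRight_apply, sub_smul]
  rw [this, Finset.sum_mul]
  refine (norm_sum_le _ _).trans (Finset.sum_le_sum fun j _ => ?_)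
  rw [norm_smul, e.norm_eq_one, mul_one, Real.norm_eq_abs]
  exact hℓ j v γ hγ

/-! ### Responses of a Zermelo system -/

namespace ZermeloSystem

variable (Z : ZermeloSystem)

lemma contDiffOn_velocity :
    ContDiffOn ℝ ((⊤ : ℕ∞) : WithTop ℕ∞) (fun z : Plane × Plane => Z.velocity z.1 z.2)
      (Z.dom ×ˢ univ) := by
  have h1 : MapsTo (Prod.fst : Plane × Plane → Plane) (Z.dom ×ˢ univ) Z.dom := fun z hz => hz.1
  refine (Z.smooth_drift.comp contDiff_fst.contDiffOn h1).add (ContDiffOn.sum fun i _ => ?_)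
  have h2 : ContDiff ℝ ((⊤ : ℕ∞) : WithTop ℕ∞) fun z : Plane × Plane => z.2 i := by fun_prop
  exact h2.contDiffOn.smul ((Z.smooth_field i).comp contDiff_fst.contDiffOn h1)

/-- Near a compact subset of the domain, and for controls in the unit ball, the dynamics coincides
with a smooth compactly supported control system. -/
lemma exists_cutoff {K : Set Plane} (hK : IsCompact K) (hKd : K ⊆ Z.dom) :
    ∃ (g : Plane × Plane → Plane) (U : Set Plane), ContDiff ℝ 2 g ∧ HasCompactSupport g ∧
      IsOpen U ∧ K ⊆ U ∧ U ⊆ Z.dom ∧ ∀ x ∈ U, ∀ v : Plane, ‖v‖ ≤ 1 →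
        g =ᶠ[𝓝 (x, v)] fun z => Z.velocity z.1 z.2 := by
  obtain ⟨U, hUo, hKU, hUd, hUc⟩ := exists_open_between_and_isCompact_closure hK Z.isOpen_dom hKd
  have hS : IsCompact (closure U ×ˢ Metric.closedBall (0 : Plane) 1) :=
    hUc.prod (isCompact_closedBall 0 1)
  have hW : IsOpen (Z.dom ×ˢ (univ : Set Plane)) := Z.isOpen_dom.prod isOpen_univ
  obtain ⟨V, hVo, hSV, hVd, hVc⟩ := exists_open_between_and_isCompact_closure hS hW
    (prod_mono hUd (subset_univ _))
  obtain ⟨χ, hχ1, hχ0, -⟩ := exists_contMDiffMap_one_nhds_of_subset_interior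
    (n := (⊤ : ℕ∞)) (modelWithCornersSelf ℝ (Plane × Plane)) hS.isClosed
    (hSV.trans (interior_maximal subset_closure hVo))
  have hχ : ContDiff ℝ ((⊤ : ℕ∞) : WithTop ℕ∞) χ := χ.contMDiff.contDiff
  refine ⟨fun z => χ z • Z.velocity z.1 z.2, U, ?_, ?_, hUo, hKU, subset_closure.trans hUd, ?_⟩
  · rw [contDiff_iff_contDiffAt]
    intro z
    by_cases hz : z ∈ Z.dom ×ˢ (univ : Set Plane)
    · exact (hχ.contDiffAt.smul (Z.contDiffOn_velocity.contDiffAt (hW.mem_nhds hz))).of_le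
        (WithTop.coe_le_coe.2 (le_top : (2 : ℕ∞) ≤ ⊤))
    · have : (fun z : Plane × Plane => χ z • Z.velocity z.1 z.2) =ᶠ[𝓝 z] fun _ => 0 := by
        filter_upwards [isClosed_closure.isOpen_compl.mem_nhds (fun h => hz (hVd h))] with y hy
        rw [hχ0 y hy, zero_smul]
      exact contDiffAt_const.congr_of_eventuallyEq this
  · refine HasCompactSupport.intro hVc fun z hz => ?_
    rw [hχ0 z hz, zero_smul]
  · intro x hx v hv
    have hxv : (x, v) ∈ closure U ×ˢ Metric.closedBall (0 : Plane) 1 :=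
      ⟨subset_closure hx, by simpa using hv⟩
    filter_upwards [hχ1.filter_mono (nhds_le_nhdsSet hxv)] with z hz
    rw [hz, one_smul]

variable {Z}

lemma integral_velocity_eq {u : Control} (hu : u ∈ circleControls) {s : ℝ} (hs : 0 ≤ s)
    {γ : ℝ → Plane} {g : Plane × Plane → Plane}
    (hg : ∀ r ∈ Icc 0 s, ∀ v : Plane, ‖v‖ ≤ 1 → g (γ r, v) = Z.velocity (γ r) v) :
    ∫ r in (0 : ℝ)..s, g (γ r, (u : ℝ → Plane) r) =
      ∫ r in (0 : ℝ)..s, Z.velocity (γ r) ((u : ℝ → Plane) r) := by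
  refine intervalIntegral.integral_congr_ae ?_
  filter_upwards [(ae_restrict_iff' measurableSet_Ici).1 hu] with r hr hrs
  rw [uIoc_of_le hs] at hrs
  exact hg r ⟨hrs.1.le, hrs.2⟩ _ (hr hrs.1.le).le

lemma IsResponse.isTrajectory {x₀ : Plane} {u : Control} {t : ℝ} {γ : ℝ → Plane}
    (h : Z.IsResponse x₀ u t γ) (hu : u ∈ circleControls) {g : Plane × Plane → Plane}
    (hg : ∀ r ∈ Icc 0 t, ∀ v : Plane, ‖v‖ ≤ 1 → g (γ r, v) = Z.velocity (γ r) v) :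
    IsTrajectory g x₀ u t γ :=
  ⟨h.1, fun s hs => by
    rw [integral_velocity_eq hu hs.1 fun r hr => hg r ⟨hr.1, hr.2.trans hs.2⟩]
    exact (h.2 s hs).2⟩

/-- Uniqueness of responses. Neither is assumed to stay near the other, so the system is cut off
around the union of both images. -/
lemma IsResponse.eqOn {x₀ : Plane} {u : Control} {t : ℝ} {γ η : ℝ → Plane}
    (hγ : Z.IsResponse x₀ u t γ) (hη : Z.IsResponse x₀ u t η) (hu : u ∈ circleControls) :
    EqOn γ η (Icc 0 t) := by
  obtain ⟨g, U, hg, hc, -, hKU, -, hgU⟩ := Z.exists_cutoff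
    ((isCompact_Icc.image_of_continuousOn hγ.1).union (isCompact_Icc.image_of_continuousOn hη.1))
    (union_subset (by rintro _ ⟨s, hs, rfl⟩; exact (hγ.2 s hs).1)
      (by rintro _ ⟨s, hs, rfl⟩; exact (hη.2 s hs).1))
  obtain ⟨C, -, hC⟩ := exists_norm_trajectory_sub_le hg hc t
  intro s hs
  have := hC x₀ u u 0 t η γ le_rfl le_rfl u.aestronglyMeasurable u.aestronglyMeasurable (by simp)
    (hη.isTrajectory hu fun r hr v hv =>
      (hgU _ (hKU (Or.inr (mem_image_of_mem _ hr))) v hv).self_of_nhds)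
    (hγ.isTrajectory hu fun r hr v hv =>
      (hgU _ (hKU (Or.inl (mem_image_of_mem _ hr))) v hv).self_of_nhds) s hs
  rw [mul_zero] at this
  exact sub_eq_zero.1 (norm_le_zero_iff.1 this)

lemma IsResponse.extremity_eq {x₀ : Plane} {u : Control} {t : ℝ} {γ : ℝ → Plane}
    (hγ : Z.IsResponse x₀ u t γ) (hu : u ∈ circleControls) (ht : 0 ≤ t) :
    Z.extremity x₀ t u = γ t := by
  have h : Z.HasResponse x₀ u t := ⟨γ, hγ⟩
  rw [extremity, dif_pos h]
  exact h.choose_spec.eqOn hγ hu ⟨ht, le_rfl⟩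

/-- Around a reference response, the extremity mapping on circle-valued controls is the end point
mapping of a smooth compactly supported control system. -/
lemma IsResponse.exists_local_flow {x₀ : Plane} {u : Control} {T : ℝ} {q : ℝ → Plane}
    (hq : Z.IsResponse x₀ u T q) (hu : u ∈ circleControls) (hT : 0 ≤ T) :
    ∃ (g : Plane × Plane → Plane) (γ : Control → ℝ → Plane) (η ρ : ℝ),
      ContDiff ℝ 2 g ∧ HasCompactSupport g ∧ 0 < η ∧ 0 < ρ ∧
      (∀ v : Control, IsTrajectory g x₀ v (T + η) (γ v)) ∧
      EqOn (γ u) q (Icc 0 T) ∧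
      (∀ s ∈ Icc 0 T, ∀ w : Plane, ‖w‖ ≤ 1 →
        g =ᶠ[𝓝 (q s, w)] fun z => Z.velocity z.1 z.2) ∧
      ∀ v ∈ circleControls, ‖v - u‖ < ρ → ∀ t ∈ Icc 0 (T + η),
        Z.HasResponse x₀ v t ∧ Z.extremity x₀ t v = γ v t := by
  obtain ⟨g, U, hg, hc, hUo, hKU, hUd, hgU⟩ := Z.exists_cutoff
    (isCompact_Icc.image_of_continuousOn hq.1)
    (by rintro _ ⟨s, hs, rfl⟩; exact (hq.2 s hs).1)
  have hqU : ∀ s ∈ Icc 0 T, q s ∈ U := fun s hs => hKU (mem_image_of_mem _ hs)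
  choose γ hγ using fun v : Control =>
    exists_isTrajectory hg hc x₀ v.aestronglyMeasurable (by linarith : 0 ≤ T + 1)
  obtain ⟨C, hC0, hC⟩ := exists_norm_trajectory_sub_le hg hc (T + 1)
  have hγq : EqOn (γ u) q (Icc 0 T) := fun s hs => by
    have := hC x₀ u u 0 T q (γ u) (by linarith) le_rfl u.aestronglyMeasurable
      u.aestronglyMeasurable (by simp)
      (hq.isTrajectory hu fun r hr v hv => (hgU _ (hqU r hr) v hv).self_of_nhds)
      ((hγ u).mono (by linarith)) s hs
    rw [mul_zero] at this
    exact sub_eq_zero.1 (norm_le_zero_iff.1 this)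
  -- The reference trajectory stays in `U` a little after time `T`.
  obtain ⟨η, hη0, hη1, hηU⟩ : ∃ η, 0 < η ∧ η ≤ 1 ∧ ∀ s ∈ Icc 0 (T + η), γ u s ∈ U := by
    have hT1 : T ∈ Icc 0 (T + 1) := ⟨hT, by linarith⟩
    have hmem : γ u ⁻¹' U ∈ 𝓝[Icc 0 (T + 1)] T :=
      (hγ u).1 T hT1 (hUo.mem_nhds (by rw [hγq ⟨hT, le_rfl⟩]; exact hqU T ⟨hT, le_rfl⟩))
    obtain ⟨δ, hδ, hball⟩ := Metric.mem_nhdsWithin_iff.1 hmem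
    refine ⟨min (δ / 2) 1, by positivity, min_le_right _ _, fun s hs => ?_⟩
    rcases le_or_gt s T with h | h
    · rw [hγq ⟨hs.1, h⟩]
      exact hqU s ⟨hs.1, h⟩
    · have h1 := min_le_left (δ / 2) 1
      have h2 := min_le_right (δ / 2) 1
      refine hball ⟨?_, hs.1, by linarith [hs.2]⟩
      rw [Metric.mem_ball, Real.dist_eq, abs_of_pos (sub_pos.2 h)]
      linarith [hs.2]
  obtain ⟨δ, hδ0, hδU⟩ := (isCompact_Icc.image_of_continuousOn
    ((hγ u).mono (by linarith : T + η ≤ T + 1)).1).exists_thickening_subset_open hUo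
    (by rintro _ ⟨s, hs, rfl⟩; exact hηU s hs)
  have hγU : ∀ v : Control, ‖v - u‖ < δ / (C + 1) → ∀ s ∈ Icc 0 (T + η), γ v s ∈ U := by
    intro v hv s hs
    refine hδU (Metric.mem_thickening_iff.2 ⟨_, mem_image_of_mem _ hs, ?_⟩)
    rw [dist_eq_norm]
    rw [lt_div_iff₀ (by positivity)] at hv
    have := hC x₀ u v ‖v - u‖ (T + η) (γ u) (γ v) (by linarith) (norm_nonneg _)
      u.aestronglyMeasurable v.aestronglyMeasurable (Control.ae_norm_sub_le u v)
      ((hγ u).mono (by linarith)) ((hγ v).mono (by linarith)) s hs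
    nlinarith [norm_nonneg (v - u)]
  refine ⟨g, γ, η, δ / (C + 1), hg, hc, hη0, by positivity, fun v => (hγ v).mono (by linarith), hγq,
    fun s hs => hgU _ (hqU s hs), fun v hv hvu t ht => ?_⟩
  have hr : Z.IsResponse x₀ v t (γ v) := by
    have htr := (hγ v).mono (by linarith [ht.2] : t ≤ T + 1)
    refine ⟨htr.1, fun s hs => ⟨hUd (hγU v hvu s ⟨hs.1, hs.2.trans ht.2⟩), ?_⟩⟩
    rw [htr.2 s hs, integral_velocity_eq hv hs.1 fun r hr w hw =>
      (hgU _ (hγU v hvu r ⟨hr.1, hr.2.trans (hs.2.trans ht.2)⟩) w hw).self_of_nhds]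
  exact ⟨⟨_, hr⟩, hr.extremity_eq hv ht.1⟩

end ZermeloSystem

/-! ### The maximized Hamiltonian -/

/-- Derivative of the Euclidean norm of a tuple of functions where it does not vanish. -/
lemma HasFDerivAt.sqrt_sum_sq {F ι : Type*} [NormedAddCommGroup F] [NormedSpace ℝ F] [Fintype ι]
    {f : ι → F → ℝ} {f' : ι → F →L[ℝ] ℝ} {x : F} (hf : ∀ i, HasFDerivAt (f i) (f' i) x)
    (h0 : ∑ i, f i x ^ 2 ≠ 0) :
    HasFDerivAt (fun y => Real.sqrt (∑ i, f i y ^ 2))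
      (∑ i, (f i x / Real.sqrt (∑ j, f j x ^ 2)) • f' i) x := by
  have h := (HasFDerivAt.fun_sum (u := Finset.univ) fun i _ => (hf i).pow 2).sqrt h0
  refine h.congr_fderiv ?_
  rw [Finset.smul_sum]
  refine Finset.sum_congr rfl fun i _ => ?_
  rw [smul_smul]
  congr 1
  simp
  ring

namespace ZermeloSystem

variable (Z : ZermeloSystem)

lemma sum_fieldLift_sq_pos {q p : Plane} (hq : q ∈ Z.dom) (hp : p ≠ 0) :
    0 < ∑ i, Z.fieldLift i q p ^ 2 := by
  refine lt_of_le_of_ne (Finset.sum_nonneg fun i _ => sq_nonneg _) fun h => hp ?_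
  have hz : ∀ i, inner ℝ p (Z.field i q) = 0 := fun i => by
    have := (Finset.sum_eq_zero_iff_of_nonneg fun i _ => sq_nonneg (Z.fieldLift i q p)).1 h.symm i
      (Finset.mem_univ i)
    exact pow_eq_zero_iff two_ne_zero |>.1 this
  have hspan := (Z.frame q hq).span_eq_top_of_card_eq_finrank' (by simp)
  have hle : Submodule.span ℝ (range fun i => Z.field i q) ≤ (ℝ ∙ p)ᗮ := by
    rw [Submodule.span_le]
    rintro _ ⟨i, rfl⟩
    exact Submodule.mem_orthogonal_singleton_iff_inner_right.2 (hz i)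
  rw [hspan] at hle
  exact inner_self_eq_zero.1 (Submodule.mem_orthogonal_singleton_iff_inner_right.1
    (hle (Submodule.mem_top (x := p))))

lemma inner_velocity (q p v : Plane) :
    inner ℝ p (Z.velocity q v) = Z.driftLift q p + ∑ i, v i * Z.fieldLift i q p := by
  simp [velocity, driftLift, fieldLift, inner_add_right, inner_smul_right]

/-- The controlled part of the Hamiltonian is a multiple of the pairing with the maximizing
control. -/
lemma sum_mul_fieldLift {q p : Plane} (hq : q ∈ Z.dom) (hp : p ≠ 0) (v : Plane) :
    ∑ i, v i * Z.fieldLift i q p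
      = Real.sqrt (∑ i, Z.fieldLift i q p ^ 2) * inner ℝ (Z.maxControl q p) v := by
  have h0 := (Real.sqrt_pos.2 (Z.sum_fieldLift_sq_pos hq hp)).ne'
  rw [PiLp.inner_apply, Finset.mul_sum]
  refine Finset.sum_congr rfl fun i _ => ?_
  simp only [maxControl, RCLike.inner_apply, conj_trivial]
  field_simp

lemma norm_maxControl {q p : Plane} (hq : q ∈ Z.dom) (hp : p ≠ 0) :
    ‖Z.maxControl q p‖ = 1 := by
  have h0 := Z.sum_fieldLift_sq_pos hq hp
  rw [EuclideanSpace.norm_eq]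
  simp only [maxControl, Real.norm_eq_abs, sq_abs, div_pow]
  rw [← Finset.sum_div, Real.sq_sqrt h0.le, div_self h0.ne', Real.sqrt_one]

lemma inner_velocity_maxControl {q p : Plane} (hq : q ∈ Z.dom) (hp : p ≠ 0) :
    inner ℝ p (Z.velocity q (Z.maxControl q p)) = Z.maxHamiltonian 0 q p := by
  rw [inner_velocity, sum_mul_fieldLift Z hq hp, real_inner_self_eq_norm_sq,
    norm_maxControl Z hq hp, maxHamiltonian]
  ring

lemma gradient_maxHamiltonian_costate (p₀ : ℝ) {q p : Plane} (hq : q ∈ Z.dom) (hp : p ≠ 0) :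
    gradient (fun y => Z.maxHamiltonian p₀ q y) p = Z.velocity q (Z.maxControl q p) := by
  apply HasGradientAt.gradient
  rw [hasGradientAt_iff_hasFDerivAt]
  have hin : ∀ w : Plane, HasFDerivAt (fun y : Plane => inner ℝ y w) (innerSL ℝ w) p := fun w => by
    have := (innerSL ℝ w).hasFDerivAt (x := p)
    refine this.congr_of_eventuallyEq (Filter.Eventually.of_forall fun y => ?_)
    simp [real_inner_comm]
  have h := ((hin (Z.drift q)).add (HasFDerivAt.sqrt_sum_sq (f := fun i y => Z.fieldLift i q y)
    (fun i => hin (Z.field i q)) (Z.sum_fieldLift_sq_pos hq hp).ne')).add_const p₀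
  refine h.congr_fderiv (ContinuousLinearMap.ext fun w => ?_)
  simp [velocity, maxControl]

lemma hasFDerivAt_velocity {q : Plane} (hq : q ∈ Z.dom) (v : Plane) :
    HasFDerivAt (fun x => Z.velocity x v)
      (fderiv ℝ Z.drift q + ∑ i, v i • fderiv ℝ (Z.field i) q) q := by
  have hn := Z.isOpen_dom.mem_nhds hq
  refine ((Z.smooth_drift.contDiffAt hn).differentiableAt (by simp)).hasFDerivAt.add ?_
  exact HasFDerivAt.fun_sum fun i _ =>
    (((Z.smooth_field i).contDiffAt hn).differentiableAt (by simp)).hasFDerivAt.fun_const_smul _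

lemma gradient_maxHamiltonian_state (p₀ : ℝ) {q p : Plane} (hq : q ∈ Z.dom) (hp : p ≠ 0)
    {D : Plane →L[ℝ] Plane} (hD : HasFDerivAt (fun x => Z.velocity x (Z.maxControl q p)) D q) :
    gradient (fun x => Z.maxHamiltonian p₀ x p) q = D.adjoint p := by
  apply HasGradientAt.gradient
  rw [hasGradientAt_iff_hasFDerivAt, hD.unique (Z.hasFDerivAt_velocity hq _)]
  have hn := Z.isOpen_dom.mem_nhds hq
  have h0 := ((Z.smooth_drift.contDiffAt hn).differentiableAt (by simp)).hasFDerivAt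
  have h1 := fun i => (((Z.smooth_field i).contDiffAt hn).differentiableAt (by simp)).hasFDerivAt
  have h := (((innerSL ℝ p).hasFDerivAt.comp q h0).add
    (HasFDerivAt.sqrt_sum_sq (f := fun i x => Z.fieldLift i x p)
    (fun i => (innerSL ℝ p).hasFDerivAt.comp q (h1 i))
    (Z.sum_fieldLift_sq_pos hq hp).ne')).add_const p₀
  refine h.congr_fderiv (ContinuousLinearMap.ext fun w => ?_)
  simp only [_root_.add_apply, _root_.sum_apply,
    InnerProductSpace.toDual_apply_apply, ContinuousLinearMap.adjoint_inner_left,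
    inner_add_right, inner_sum, inner_smul_right, maxControl, _root_.smul_apply,
    ContinuousLinearMap.comp_apply, innerSL_apply_apply, smul_eq_mul]

lemma continuousOn_fieldLift {s : Set ℝ} {q p : ℝ → Plane} (hq : ContinuousOn q s)
    (hp : ContinuousOn p s) (hd : ∀ t ∈ s, q t ∈ Z.dom) (i : Fin 2) :
    ContinuousOn (fun t => Z.fieldLift i (q t) (p t)) s :=
  hp.inner ((Z.smooth_field i).continuousOn.comp hq hd)

lemma continuousOn_maxControl {s : Set ℝ} {q p : ℝ → Plane} (hq : ContinuousOn q s)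
    (hp : ContinuousOn p s) (hd : ∀ t ∈ s, q t ∈ Z.dom) (h0 : ∀ t ∈ s, p t ≠ 0) :
    ContinuousOn (fun t => Z.maxControl (q t) (p t)) s := by
  have h := Z.continuousOn_fieldLift hq hp hd
  refine (PiLp.continuous_toLp 2 _).comp_continuousOn (continuousOn_pi.2 fun i => (h i).div ?_ ?_)
  · exact Real.continuous_sqrt.comp_continuousOn
      (continuousOn_finsetSum _ fun j _ => (h j).pow 2)
  · exact fun t ht => (Real.sqrt_pos.2 (Z.sum_fieldLift_sq_pos (hd t ht) (h0 t ht))).ne'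

end ZermeloSystem

/-! ### Derivatives along sets -/

/-- If one coordinate of `f` has zero derivative along `S`, then so does that coordinate of the
derivative of `f` on the tangent space, which therefore is not mapped onto the whole space. -/
lemma IsSingularity.of_inner {X Y : Type*} [NormedAddCommGroup X] [NormedSpace ℝ X]
    [NormedAddCommGroup Y] [InnerProductSpace ℝ Y] {f : X → Y} {D S : Set X} {x : X} {n : Y}
    {f' : X →L[ℝ] Y} (hx : x ∈ S) (hD : D ∈ 𝓝[S] x) (hf : HasFDerivWithinAt f f' S x) (hn : n ≠ 0)
    (h0 : HasFDerivWithinAt (fun y => inner ℝ n (f y)) (0 : X →L[ℝ] ℝ) S x) :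
    IsSingularity f D S x := by
  refine ⟨hx, hD, f', hf, fun htop => hn ?_⟩
  have heq := ((innerSL ℝ n).hasFDerivAt.comp_hasFDerivWithinAt x hf).unique_on h0
  have hle : (Submodule.span ℝ (tangentConeAt ℝ S x)).map (f' : X →ₗ[ℝ] Y) ≤ (ℝ ∙ n)ᗮ := by
    rw [Submodule.map_span, Submodule.span_le]
    rintro _ ⟨y, hy, rfl⟩
    exact Submodule.mem_orthogonal_singleton_iff_inner_right.2 (heq hy)
  rw [htop] at hle
  exact inner_self_eq_zero.1 (Submodule.mem_orthogonal_singleton_iff_inner_right.1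
    (hle (Submodule.mem_top (x := n))))

lemma eq_right_endpoint_of_ae_eq {Y : Type*} [TopologicalSpace Y] [T2Space Y] {T : ℝ} (hT : 0 < T)
    {f g : ℝ → Y} (hf : ContinuousWithinAt f (Icc 0 T) T) (hg : ContinuousWithinAt g (Icc 0 T) T)
    (h : ∀ᵐ r ∂(volume.restrict (Icc 0 T)), f r = g r) : f T = g T := by
  have hD : Dense {r | r ∈ Icc 0 T → f r = g r} :=
    Measure.dense_of_ae ((ae_restrict_iff' measurableSet_Icc).1 h)
  have hmem : T ∈ closure (Ioo 0 T ∩ {r | r ∈ Icc 0 T → f r = g r}) := by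
    refine closure_minimal (hD.open_subset_closure_inter isOpen_Ioo) isClosed_closure ?_
    rw [closure_Ioo hT.ne]
    exact ⟨hT.le, le_rfl⟩
  have := mem_closure_iff_nhdsWithin_neBot.1 hmem
  have hsub : Ioo 0 T ∩ {r | r ∈ Icc 0 T → f r = g r} ⊆ Icc 0 T :=
    inter_subset_left.trans Ioo_subset_Icc_self
  refine tendsto_nhds_unique_of_eventuallyEq (hf.mono hsub) (hg.mono hsub) ?_
  filter_upwards [self_mem_nhdsWithin] with r hr
  exact hr.2 (hsub hr)

lemma hasFDerivWithinAt_of_norm_sub_le_sq {X Y : Type*} [NormedAddCommGroup X] [NormedSpace ℝ X]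
    [NormedAddCommGroup Y] [NormedSpace ℝ Y] {f : X → Y} {f' : X →L[ℝ] Y} {S : Set X} {x : X}
    {C : ℝ} (h : ∀ y ∈ S, ‖f y - f x - f' (y - x)‖ ≤ C * ‖y - x‖ ^ 2) :
    HasFDerivWithinAt f f' S x := by
  refine .of_isLittleO ?_
  have hO : (fun y => f y - f x - f' (y - x)) =O[𝓝[S] x] fun y => ‖y - x‖ ^ 2 := by
    refine Asymptotics.IsBigO.of_bound C ?_
    filter_upwards [self_mem_nhdsWithin] with y hy
    simpa using h y hy
  refine hO.trans_isLittleO ?_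
  have ht : Filter.Tendsto (fun y => y - x) (𝓝[S] x) (𝓝 0) := by
    have : Filter.Tendsto (fun y => y - x) (𝓝[S] x) (𝓝 (x - x)) :=
      ((continuous_id.sub continuous_const).tendsto x).mono_left nhdsWithin_le_nhds
    simpa using this
  exact (Asymptotics.isLittleO_norm_pow_id one_lt_two).comp_tendsto ht

/-! ### Differentiability with respect to time -/

/-- For a control continuous at `T`, the trajectories have the time derivative
`g (γ u T, w T)` at `T`, uniformly with respect to nearby controls. -/
lemma hasFDerivAt_trajectory_time {g : Plane × Plane → Plane} (hg : ContDiff ℝ 2 g)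
    (hc : HasCompactSupport g) {x₀ : Plane} {T η : ℝ} (hT : 0 < T) (hη : 0 < η)
    {γ : Control → ℝ → Plane} (hγ : ∀ v : Control, IsTrajectory g x₀ v (T + η) (γ v)) {u : Control}
    {w : ℝ → Plane} (hw : ContinuousAt w T)
    (huw : (u : ℝ → Plane) =ᵐ[volume.restrict (Ici (0 : ℝ))] w) :
    HasFDerivAt (fun x : ℝ × Control => γ x.2 x.1 - γ x.2 T)
      ((ContinuousLinearMap.fst ℝ ℝ Control).smulRight (g (γ u T, w T))) (T, u) := by
  obtain ⟨M, hM⟩ := hc.exists_bound_of_continuous hg.continuous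
  obtain ⟨C, hC0, hC⟩ := exists_norm_trajectory_sub_le hg hc (T + η)
  have hTη : T ∈ Icc 0 (T + η) := ⟨hT.le, by linarith⟩
  refine .of_isLittleO (Asymptotics.isLittleO_iff.2 fun c hc0 => ?_)
  -- `g` is continuous at `(γ u T, w T)`, and the arguments in the integrand are close to it.
  obtain ⟨δ, hδ0, hδ⟩ := Metric.continuousAt_iff.1
    (hg.continuous.continuousAt (x := (γ u T, w T))) c hc0
  have hcont : ContinuousAt (γ u) T :=
    (hγ u).1.continuousAt (Icc_mem_nhds hT (by linarith))
  obtain ⟨δ₁, hδ₁, h₁⟩ := Metric.continuousAt_iff.1 (hcont.prodMk hw) (δ / 2) (by positivity)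
  set ρ := min (min δ₁ (min T η)) (δ / 2 / (C + 1)) with hρ
  have hρ0 : 0 < ρ := by positivity
  filter_upwards [Metric.ball_mem_nhds (T, u) hρ0] with x hx
  obtain ⟨t, v⟩ := x
  rw [Metric.mem_ball, Prod.dist_eq, max_lt_iff] at hx
  obtain ⟨htT, hvu⟩ := hx
  simp only at htT hvu
  rw [Real.dist_eq] at htT
  rw [dist_eq_norm] at hvu
  have hρ1 : ρ ≤ δ₁ := (min_le_left _ _).trans (min_le_left _ _)
  have hρ2 : ρ ≤ T := (min_le_left _ _).trans ((min_le_right _ _).trans (min_le_left _ _))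
  have hρ3 : ρ ≤ η := (min_le_left _ _).trans ((min_le_right _ _).trans (min_le_right _ _))
  have hρ4 : ‖v - u‖ * (C + 1) < δ / 2 := by
    rw [← lt_div_iff₀ (by positivity)]
    exact hvu.trans_le (min_le_right _ _)
  have ht : t ∈ Icc 0 (T + η) := by
    rw [abs_lt] at htT
    constructor <;> linarith
  have hi : ∀ s ∈ Icc 0 (T + η),
      IntervalIntegrable (fun r => g (γ v r, (v : ℝ → Plane) r)) volume 0 s := fun s hs =>
    intervalIntegrable_velocity hs.1 hg.continuous hM v.aestronglyMeasurable ((hγ v).mono hs.2).1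
  have hdiff : γ v t - γ v T = ∫ r in T..t, g (γ v r, (v : ℝ → Plane) r) := by
    rw [(hγ v).2 t ht, (hγ v).2 T hTη, add_sub_add_left_eq_sub,
      intervalIntegral.integral_interval_sub_left (hi t ht) (hi T hTη)]
  have hconst : (t - T) • g (γ u T, w T) = ∫ _ in T..t, g (γ u T, w T) := by
    rw [intervalIntegral.integral_const]
  simp only [sub_self, sub_zero, Prod.mk_sub_mk, ContinuousLinearMap.smulRight_apply,
    ContinuousLinearMap.coe_fst']
  rw [hdiff, hconst, ← intervalIntegral.integral_sub ((hi T hTη).symm.trans (hi t ht))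
    intervalIntegrable_const]
  refine (intervalIntegral.norm_integral_le_of_norm_le_const_ae (C := c) ?_).trans ?_
  · have hvu' := (ae_restrict_iff' measurableSet_Ici).1 (Control.ae_norm_sub_le u v)
    have huw' := (ae_restrict_iff' measurableSet_Ici).1 huw
    filter_upwards [hvu', huw'] with r hr hrw hrt
    have hrT : |r - T| ≤ |t - T| := abs_sub_left_of_mem_uIcc (uIoc_subset_uIcc hrt)
    have hr' : r ∈ Icc 0 (T + η) := by
      have := hrT.trans_lt htT
      rw [abs_lt] at this
      constructor <;> linarith
    have d1 := h₁ (show dist r T < δ₁ by rw [Real.dist_eq]; linarith)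
    rw [Prod.dist_eq, max_lt_iff, dist_eq_norm, dist_eq_norm] at d1
    have d2 := hC x₀ u v ‖v - u‖ (T + η) (γ u) (γ v) le_rfl (norm_nonneg _) u.aestronglyMeasurable
      v.aestronglyMeasurable (Control.ae_norm_sub_le u v) (hγ u) (hγ v) r hr'
    have d3 := hr hr'.1
    rw [hrw hr'.1] at d3
    rw [← dist_eq_norm]
    refine (hδ ?_).le
    have e1 := norm_sub_le_norm_sub_add_norm_sub (γ v r) (γ u r) (γ u T)
    have e2 := norm_sub_le_norm_sub_add_norm_sub ((v : ℝ → Plane) r) (w r) (w T)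
    have hn := norm_nonneg (v - u)
    have hCn := mul_nonneg hC0 hn
    rw [Prod.dist_eq, max_lt_iff, dist_eq_norm, dist_eq_norm]
    simp only at d1 ⊢
    constructor <;> linarith
  · gcongr
    exact (Real.norm_eq_abs _).symm.le.trans (norm_fst_le (t - T, v - u))

/-! ### Variations of an extremal -/

namespace ZermeloSystem

variable {Z : ZermeloSystem} {T p₀ : ℝ} {q p : ℝ → Plane}

namespace IsExtremal

lemma continuousOn_state (hz : Z.IsExtremal T p₀ q p) : ContinuousOn q (Icc 0 T) :=
  fun t ht => (hz.hasDeriv_state t ht).continuousWithinAt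

lemma continuousOn_adjoint (hz : Z.IsExtremal T p₀ q p) : ContinuousOn p (Icc 0 T) :=
  fun t ht => (hz.hasDeriv_adjoint t ht).continuousWithinAt

lemma continuousOn_control (hz : Z.IsExtremal T p₀ q p) :
    ContinuousOn (fun t => Z.maxControl (q t) (p t)) (Icc 0 T) :=
  Z.continuousOn_maxControl hz.continuousOn_state hz.continuousOn_adjoint hz.mem_dom
    hz.adjoint_ne_zero

lemma norm_control (hz : Z.IsExtremal T p₀ q p) {t : ℝ} (ht : t ∈ Icc 0 T) :
    ‖Z.maxControl (q t) (p t)‖ = 1 :=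
  Z.norm_maxControl (hz.mem_dom t ht) (hz.adjoint_ne_zero t ht)

lemma isResponse (hz : Z.IsExtremal T p₀ q p) {u : Control}
    (hu : ∀ᵐ t ∂(volume.restrict (Icc 0 T)), (u : ℝ → Plane) t = Z.maxControl (q t) (p t)) :
    Z.IsResponse (q 0) u T q := by
  refine ⟨hz.continuousOn_state, fun s hs => ⟨hz.mem_dom s hs, ?_⟩⟩
  have hsT : Icc 0 s ⊆ Icc 0 T := Icc_subset_Icc_right hs.2
  have hc : ContinuousOn (fun t => Z.velocity (q t) (Z.maxControl (q t) (p t))) (Icc 0 T) :=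
    Z.contDiffOn_velocity.continuousOn.comp (hz.continuousOn_state.prodMk hz.continuousOn_control)
      fun t ht => ⟨hz.mem_dom t ht, trivial⟩
  have hftc := intervalIntegral.integral_eq_sub_of_hasDerivAt_of_le hs.1
    (hz.continuousOn_state.mono hsT) (fun t ht => by
      have ht' := hsT (Ioo_subset_Icc_self ht)
      have := (hz.hasDeriv_state t ht').hasDerivAt (Icc_mem_nhds ht.1 (ht.2.trans_le hs.2))
      rwa [Z.gradient_maxHamiltonian_costate p₀ (hz.mem_dom t ht') (hz.adjoint_ne_zero t ht')]
        at this)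
    ((hc.mono hsT).intervalIntegrable_of_Icc hs.1)
  rw [← sub_eq_iff_eq_add', ← hftc]
  refine intervalIntegral.integral_congr_ae ?_
  filter_upwards [(ae_restrict_iff' measurableSet_Icc).1 hu] with r hr hrs
  rw [uIoc_of_le hs.1] at hrs
  rw [hr ⟨hrs.1.le, hrs.2.trans hs.2⟩]

/-- The costate of an extremal solves the adjoint equation of the system linearized along the
state. -/
lemma hasDerivWithinAt_adjoint (hz : Z.IsExtremal T p₀ q p) {g : Plane × Plane → Plane}
    {t : ℝ} (ht : t ∈ Icc 0 T) (hg : Differentiable ℝ g)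
    (hgv : g =ᶠ[𝓝 (q t, Z.maxControl (q t) (p t))] fun z => Z.velocity z.1 z.2) :
    HasDerivWithinAt p (-(fderiv ℝ g (q t, Z.maxControl (q t) (p t)) ∘L
      ContinuousLinearMap.inl ℝ Plane Plane).adjoint (p t)) (Icc 0 T) t := by
  have h := hz.hasDeriv_adjoint t ht
  rwa [Z.gradient_maxHamiltonian_state p₀ (hz.mem_dom t ht) (hz.adjoint_ne_zero t ht)
    (D := fderiv ℝ g (q t, Z.maxControl (q t) (p t)) ∘L ContinuousLinearMap.inl ℝ Plane Plane)] at h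
  refine (hg.differentiableAt.hasFDerivAt.comp (q t)
    (hasFDerivAt_prodMk_left (q t) (Z.maxControl (q t) (p t)))).congr_of_eventuallyEq ?_
  have hcont : ContinuousAt (fun x : Plane => (x, Z.maxControl (q t) (p t))) (q t) := by fun_prop
  filter_upwards [hcont.eventually hgv] with x hx
  exact hx.symm

/-- Along an extremal the costate is paired with variations of the control through the maximizing
control. -/
lemma inner_fderiv_control (hz : Z.IsExtremal T p₀ q p) {g : Plane × Plane → Plane}
    {t : ℝ} (ht : t ∈ Icc 0 T) (hg : Differentiable ℝ g)
    (hgv : g =ᶠ[𝓝 (q t, Z.maxControl (q t) (p t))] fun z => Z.velocity z.1 z.2) (w : Plane) :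
    inner ℝ (p t) (fderiv ℝ g (q t, Z.maxControl (q t) (p t)) (0, w)) =
      Real.sqrt (∑ i, Z.fieldLift i (q t) (p t) ^ 2) * inner ℝ (Z.maxControl (q t) (p t)) w := by
  rw [← Z.sum_mul_fieldLift (hz.mem_dom t ht) (hz.adjoint_ne_zero t ht)]
  set us := Z.maxControl (q t) (p t) with hus
  have h1 : HasFDerivAt (fun v => Z.velocity (q t) v)
      (∑ i, (EuclideanSpace.proj i : Plane →L[ℝ] ℝ).smulRight (Z.field i (q t))) us := by
    refine HasFDerivAt.const_add _ (HasFDerivAt.fun_sum fun i _ => ?_)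
    exact (EuclideanSpace.proj i : Plane →L[ℝ] ℝ).hasFDerivAt.smul_const (Z.field i (q t))
  have h2 : HasFDerivAt (fun v => Z.velocity (q t) v)
      (fderiv ℝ g (q t, us) ∘L ContinuousLinearMap.inr ℝ Plane Plane) us := by
    refine (hg.differentiableAt.hasFDerivAt.comp us
      (hasFDerivAt_prodMk_right (q t) us)).congr_of_eventuallyEq ?_
    have hcont : ContinuousAt (fun v : Plane => (q t, v)) us := by fun_prop
    filter_upwards [hcont.eventually hgv] with x hx
    exact hx.symm
  have h3 := congrArg (fun A : Plane →L[ℝ] Plane => inner ℝ (p t) (A w)) (h2.unique h1)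
  simpa [fieldLift, inner_add_right, inner_smul_right] using h3

/-- **Orthogonality of the costate.** Variations of the control among circle-valued controls move
the end point in the direction of the costate only to second order, as `velocity` pairs with the
costate through the maximizing control, which is itself normal to the circle. -/
lemma exists_inner_endpoint_sub_le_sq (hz : Z.IsExtremal T p₀ q p) (hT : 0 ≤ T) {u : Control}
    (hcirc : u ∈ circleControls)
    (hu : ∀ᵐ t ∂(volume.restrict (Icc 0 T)), (u : ℝ → Plane) t = Z.maxControl (q t) (p t))
    {g : Plane × Plane → Plane} (hg : ContDiff ℝ 2 g) (hc : HasCompactSupport g)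
    (hgv : ∀ s ∈ Icc 0 T, ∀ w : Plane, ‖w‖ ≤ 1 →
        g =ᶠ[𝓝 (q s, w)] fun z => Z.velocity z.1 z.2)
    (hq : IsTrajectory g (q 0) u T q) :
    ∃ C : ℝ, ∀ v ∈ circleControls, ∀ γ, IsTrajectory g (q 0) v T γ →
      |inner ℝ (p T) (γ T - q T)| ≤ C * ‖v - u‖ ^ 2 := by
  have hgd : Differentiable ℝ g := hg.differentiable (by norm_num)
  have hgu := fun t ht => hgv t ht _ (hz.norm_control ht).le
  obtain ⟨C, hC⟩ := exists_inner_endpoint_sub_le hg hc hT u.aestronglyMeasurable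
    hz.continuousOn_control hu hq (fun t ht => hz.hasDerivWithinAt_adjoint ht hgd (hgu t ht))
  have hSc : ContinuousOn (fun t => Real.sqrt (∑ i, Z.fieldLift i (q t) (p t) ^ 2)) (Icc 0 T) :=
    Real.continuous_sqrt.comp_continuousOn (continuousOn_finsetSum _ fun j _ =>
      (Z.continuousOn_fieldLift hz.continuousOn_state hz.continuousOn_adjoint hz.mem_dom j).pow 2)
  obtain ⟨B, hB⟩ := isCompact_Icc.exists_bound_of_continuousOn hSc
  refine ⟨C + B * T, fun v hv γ hγ => ?_⟩
  have h1 := hC v ‖v - u‖ γ (norm_nonneg _) v.aestronglyMeasurable (Control.ae_norm_sub_le u v) hγ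
  have h2 : ‖∫ r in (0 : ℝ)..T, inner ℝ (p r) (fderiv ℝ g (q r, Z.maxControl (q r) (p r))
      (0, (v : ℝ → Plane) r - (u : ℝ → Plane) r))‖ ≤ B * ‖v - u‖ ^ 2 * |T - 0| := by
    refine intervalIntegral.norm_integral_le_of_norm_le_const_ae ?_
    have a1 := (ae_restrict_iff' measurableSet_Ici).1 hcirc
    have a2 := (ae_restrict_iff' measurableSet_Ici).1 hv
    have a3 := (ae_restrict_iff' measurableSet_Icc).1 hu
    have a4 := (ae_restrict_iff' measurableSet_Ici).1 (Control.ae_norm_sub_le u v)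
    filter_upwards [a1, a2, a3, a4] with r r1 r2 r3 r4 hr
    rw [uIoc_of_le hT] at hr
    have hrT : r ∈ Icc 0 T := ⟨hr.1.le, hr.2⟩
    have hB0 : 0 ≤ B := (norm_nonneg _).trans (hB r hrT)
    rw [hz.inner_fderiv_control hrT hgd (hgu r hrT), norm_mul, ← r3 hrT]
    refine mul_le_mul (hB r hrT) ?_ (norm_nonneg _) hB0
    -- On the unit circle `⟪u, v - u⟫ = -‖v - u‖² / 2`.
    have e := norm_sub_sq_real ((v : ℝ → Plane) r) ((u : ℝ → Plane) r)
    rw [r1 hrT.1, r2 hrT.1] at e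
    have e2 : inner ℝ ((u : ℝ → Plane) r) ((v : ℝ → Plane) r - (u : ℝ → Plane) r)
        = -(‖(v : ℝ → Plane) r - (u : ℝ → Plane) r‖ ^ 2 / 2) := by
      rw [inner_sub_right, real_inner_self_eq_norm_sq, r1 hrT.1, real_inner_comm, e]
      ring
    rw [e2, norm_neg, Real.norm_of_nonneg (by positivity)]
    have := pow_le_pow_left₀ (norm_nonneg _) (r4 hrT.1) 2
    have := sq_nonneg ‖(v : ℝ → Plane) r - (u : ℝ → Plane) r‖
    linarith
  rw [sub_zero, abs_of_nonneg hT, Real.norm_eq_abs] at h2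
  have h3 := abs_add_le (inner ℝ (p T) (γ T - q T) - ∫ r in (0 : ℝ)..T, inner ℝ (p r)
    (fderiv ℝ g (q r, Z.maxControl (q r) (p r)) (0, (v : ℝ → Plane) r - (u : ℝ → Plane) r)))
    (∫ r in (0 : ℝ)..T, inner ℝ (p r)
    (fderiv ℝ g (q r, Z.maxControl (q r) (p r)) (0, (v : ℝ → Plane) r - (u : ℝ → Plane) r)))
  rw [sub_add_cancel] at h3
  linarith

end IsExtremal

end ZermeloSystem

/-! ### Singularities of the extremity mappings -/

theorem mainTheorem9 (Z : ZermeloSystem) (T : ℝ) (hT : 0 < T) (p₀ : ℝ) (q p : ℝ → Plane)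
    (hz : Z.IsExtremal T p₀ q p) (u : Control) (hcirc : u ∈ circleControls)
    (hu : ∀ᵐ t ∂(volume.restrict (Icc 0 T)), (u : ℝ → Plane) t = Z.maxControl (q t) (p t)) :
    (p₀ ≠ 0 → Z.IsFixedTimeSingularity (q 0) T u) ∧
    (p₀ = 0 →
      -- the continuation of the control to times after `T` is continuous at `T`
      (∃ w : ℝ → Plane, ContinuousAt w T ∧
        (u : ℝ → Plane) =ᵐ[volume.restrict (Ici (0 : ℝ))] w) →
      Z.IsFreeTimeSingularity (q 0) T u) := by
  have hresp := hz.isResponse hu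
  obtain ⟨g, γ, η, ρ, hg, hc, hη, hρ, hγ, hγq, hgv, hloc⟩ :=
    hresp.exists_local_flow hcirc hT.le
  have hTT : T ∈ Icc 0 T := ⟨hT.le, le_rfl⟩
  have hTη : T ∈ Icc 0 (T + η) := ⟨hT.le, by linarith⟩
  have hqt : IsTrajectory g (q 0) u T q :=
    hresp.isTrajectory hcirc fun r hr v hv => (hgv r hr v hv).self_of_nhds
  have hγT := fun v => (hγ v).mono (by linarith : T ≤ T + η)
  obtain ⟨f', C, hf'⟩ := exists_endpoint_derivative hg hc hT.le hz.continuousOn_control hu hqt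
  obtain ⟨C', hC'⟩ := hz.exists_inner_endpoint_sub_le_sq hT.le hcirc hu hg hc hgv hqt
  have hpT : p T ≠ 0 := hz.adjoint_ne_zero T hTT
  have hend : HasFDerivAt (fun v : Control => γ v T) f' u := by
    rw [← hasFDerivWithinAt_univ]
    refine hasFDerivWithinAt_of_norm_sub_le_sq (C := C) fun v _ => ?_
    rw [hγq hTT]
    exact hf' v _ (hγT v)
  have hinner : HasFDerivWithinAt (fun v : Control => inner ℝ (p T) (γ v T)) (0 : Control →L[ℝ] ℝ)
      circleControls u := by
    refine hasFDerivWithinAt_of_norm_sub_le_sq (C := C') fun v hv => ?_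
    rw [hγq hTT, ← inner_sub_right, _root_.zero_apply, sub_zero]
    exact hC' v hv _ (hγT v)
  have hball : ∀ᶠ v in 𝓝 u, ‖v - u‖ < ρ := by
    filter_upwards [Metric.ball_mem_nhds u hρ] with v hv
    rwa [Metric.mem_ball, dist_eq_norm] at hv
  refine ⟨fun _ => ?_, fun hp0 => ?_⟩
  · have hev : ∀ᶠ v in 𝓝[circleControls] u,
        Z.HasResponse (q 0) v T ∧ Z.extremity (q 0) T v = γ v T := by
      filter_upwards [self_mem_nhdsWithin, hball.filter_mono nhdsWithin_le_nhds] with v hv hvu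
      exact hloc v hv hvu T hTη
    have hu' := (hev.self_of_nhdsWithin hcirc).2
    exact IsSingularity.of_inner hcirc (hev.mono fun v hv => hv.1)
      (hend.hasFDerivWithinAt.congr_of_eventuallyEq (hev.mono fun v hv => hv.2) hu') hpT
      (hinner.congr_of_eventuallyEq (hev.mono fun v hv => congrArg _ hv.2) (congrArg _ hu'))
  · rintro ⟨w, hw, huw⟩
    have hmem : (T, u) ∈ Ici (0 : ℝ) ×ˢ circleControls := ⟨hT.le, hcirc⟩
    have hev : ∀ᶠ x in 𝓝[Ici (0 : ℝ) ×ˢ circleControls] (T, u),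
        Z.HasResponse (q 0) x.2 x.1 ∧ Z.extremity (q 0) x.1 x.2 = γ x.2 x.1 := by
      have h1 : ∀ᶠ x : ℝ × Control in 𝓝 (T, u), ‖x.2 - u‖ < ρ :=
        (continuous_snd.tendsto (T, u)).eventually hball
      have h2 : ∀ᶠ x : ℝ × Control in 𝓝 (T, u), x.1 < T + η :=
        continuous_fst.continuousAt.eventually (gt_mem_nhds (by linarith : T < T + η))
      filter_upwards [self_mem_nhdsWithin, h1.filter_mono nhdsWithin_le_nhds,
        h2.filter_mono nhdsWithin_le_nhds] with x hx hx1 hx2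
      exact hloc x.2 hx.2 hx1 x.1 ⟨hx.1, hx2.le⟩
    have hu' := (hev.self_of_nhdsWithin hmem).2
    have htime := hasFDerivAt_trajectory_time hg hc hT hη hγ hw huw
    have hwT : w T = Z.maxControl (q T) (p T) := by
      have hTIci : volume.restrict (Icc 0 T) ≤ volume.restrict (Ici 0) :=
        restrict_Icc_le_restrict_Ici T
      have hwu : ∀ᵐ r ∂(volume.restrict (Icc 0 T)), (u : ℝ → Plane) r = w r := ae_mono hTIci huw
      refine eq_right_endpoint_of_ae_eq hT hw.continuousWithinAt (hz.continuousOn_control T hTT) ?_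
      filter_upwards [hwu, hu] with r h1 h2
      rw [← h1, h2]
    have hort : inner ℝ (p T) (g (γ u T, w T)) = 0 := by
      rw [hγq hTT, hwT, (hgv T hTT _ (hz.norm_control hTT).le).self_of_nhds,
        Z.inner_velocity_maxControl (hz.mem_dom T hTT) hpT]
      exact hp0 ▸ hz.level T hTT
    have hsum : ∀ x : ℝ × Control, γ x.2 x.1 = (γ x.2 x.1 - γ x.2 T) + γ x.2 T :=
      fun x => (sub_add_cancel _ _).symm
    have hflow : HasFDerivWithinAt (fun x : ℝ × Control => γ x.2 x.1)
        ((ContinuousLinearMap.fst ℝ ℝ Control).smulRight (g (γ u T, w T)) +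
          f' ∘L ContinuousLinearMap.snd ℝ ℝ Control) (Ici (0 : ℝ) ×ˢ circleControls) (T, u) := by
      rw [funext hsum]
      exact (htime.add (hend.comp (T, u) hasFDerivAt_snd)).hasFDerivWithinAt
    have hflow0 : HasFDerivWithinAt (fun x : ℝ × Control => inner ℝ (p T) (γ x.2 x.1))
        (0 : ℝ × Control →L[ℝ] ℝ) (Ici (0 : ℝ) ×ˢ circleControls) (T, u) := by
      have h1 := ((innerSL ℝ (p T)).hasFDerivAt.comp (T, u) htime).hasFDerivWithinAt
        (s := Ici (0 : ℝ) ×ˢ circleControls)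
      have h2 := hinner.comp (T, u)
        (hasFDerivAt_snd (p := (T, u))).hasFDerivWithinAt (s := Ici (0 : ℝ) ×ˢ circleControls)
        (fun x hx => hx.2)
      have h3 := h1.add h2
      refine (h3.congr_fderiv ?_).congr_of_eventuallyEq
        (Filter.Eventually.of_forall fun x => ?_) ?_
      · ext x <;> simp [hort]
      · simp [inner_sub_right]
      · simp
    exact IsSingularity.of_inner hmem (hev.mono fun v hv => hv.1)
      (hflow.congr_of_eventuallyEq (hev.mono fun v hv => hv.2) hu') hpT
      (hflow0.congr_of_eventuallyEq (hev.mono fun v hv => congrArg _ hv.2) (congrArg _ hu'))
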